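/- Let $R\subset\mathbb{R}^d$ be a root system (a finite set of nonzero vectors, stable under the reflections $\sigma_\alpha(x)=x-2\langle x,\alpha\rangle\alpha/\|\alpha\|^2$, $\alpha\in R$), let $G$ be the group generated by these reflections, let $R_+=\{\alpha\in R:\langle\alpha,\beta\rangle>0\}$, where $\beta\in\mathbb{R}^d$ satisfies $\langle\alpha,\beta\rangle\neq0$ for all $\alpha\in R$, and let $k:R\to\mathbb{C}$ be $G$-invariant. The Dunkl operators are $$T_\xi f(x)=\partial_\xi f(x)+\sum_{\alpha\in R_+}k(\alpha)\langle\alpha,\xi\rangle\frac{f(x)-f(\sigma_\alpha x)}{\langle\alpha,x\rangle},\qquad \xi\in\mathbb{R}^d,$$ the quotients being extended by continuity to the hyperplanes $\langle\alpha,x\rangle=0$. Let $\mathcal{P}=\mathbb{C}[\mathbb{R}^d]$ and let $\mathcal{P}_n$ be its subspace of homogeneous polynomials of degree $n$. Put $\gamma=\sum_{\alpha\in R_+}k(\alpha)$ and assume that for every $n\ge1$ the operator $p\mapsto(n+\gamma)p-\sum_{\alpha\in R_+}k(\alpha)\,p\circ\sigma_\alpha$ is invertible on $\mathcal{P}_n$.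 Let $V_k$ be the intertwining operator, that is, the linear automorphism of $\mathcal{P}$ with $V_k(\mathcal{P}_n)\subset\mathcal{P}_n$ for all $n$, $V_k(1)=1$ and $T_\xi V_k=V_k\partial_\xi$ for all $\xi\in\mathbb{R}^d$. Write $\langle\cdot,\cdot\rangle$ also for the bilinear extension of the inner product to $\mathbb{C}^d\times\mathbb{C}^d$. For $x,y\in\mathbb{C}^d$ put $$E_n(x,y)=\tfrac1{n!}V_k(\langle\cdot,y\rangle^n)(x),\qquad E_k(x,y)=\sum_{n\ge0}E_n(x,y),$$ and for $x\in\mathbb{C}^d$, $y\in\mathbb{R}^d$ put $$L_k(x,y)=\sum_{n\ge0}\bigl(e^{-\Delta/2}E_n(x,\cdot)\bigr)(y),$$ where $\Delta$ is the Laplacian of $\mathbb{R}^d$ and $e^{-\Delta/2}=\sum_{m\ge0}\frac{(-1/2)^m}{m!}\Delta^m$. For $f\in L^1(\mathbb{R}^d)$ let $$\mathcal{F}(f)(y)=(2\pi)^{-d/2}\int_{\mathbb{R}^d}f(z)e^{-i\langle y,z\rangle}\,dz .$$ Then for all $x\in\mathbb{C}^d$ and $y\in\mathbb{R}^d$ the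 series defining $L_k(x,y)$ and $E_k(ix,z)$, $z\in\mathbb{R}^d$, converge absolutely, the function $z\mapsto e^{-\|z\|^2/2}E_k(ix,z)$ is integrable on $\mathbb{R}^d$, and $$e^{-\|y\|^2/2}L_k(x,y)=\mathcal{F}\bigl(e^{-\|\cdot\|^2/2}E_k(ix,\cdot)\bigr)(y).$$ -/

import Mathlib

open scoped RealInnerProductSpace InnerProductSpace

namespace DunklTheory

noncomputable section

/-- The Euclidean space `ℝ^d`. -/
abbrev Euc (d : ℕ) : Type := EuclideanSpace ℝ (Fin d)

/-- The algebra of polynomial functions with complex coefficients on `ℝ^d`. -/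
abbrev CPoly (d : ℕ) : Type := MvPolynomial (Fin d) ℂ

variable {d : ℕ}

/-- The inclusion of `ℝ^d` in `ℂ^d`. -/
def toComplex (x : Euc d) : Fin d → ℂ := fun i => (x i : ℂ)

/-- The orthogonal reflection `σ_α` in the hyperplane orthogonal to `α`. -/
def sigma (α : Euc d) : Euc d ≃ₗᵢ[ℝ] Euc d := (ℝ ∙ α)ᗮ.reflection

/-- The usual formula for `σ_α`. -/
theorem sigma_apply (α x : Euc d) :
    sigma α x = x - (2 * ⟪x, α⟫_ℝ / ‖α‖ ^ 2) • α := by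
  rw [sigma, Submodule.reflection_orthogonal_apply, Submodule.reflection_singleton_apply,
    real_inner_comm, neg_sub, two_smul, ← add_smul]
  congr 2
  simp only [RCLike.ofReal_real_eq_id, id]
  ring

/-- A root system in `ℝ^d`: a finite set of nonzero vectors stable under the reflections in its
elements. It need not span `ℝ^d`, be crystallographic, or be reduced. -/
structure IsRootSystem (R : Finset (Euc d)) : Prop where
  zero_notMem : (0 : Euc d) ∉ R
  sigma_mem : ∀ α ∈ R, ∀ β ∈ R, sigma α β ∈ R

/-- The group generated by the reflections in the roots. -/
def reflectionGroup (R : Finset (Euc d)) : Subgroup (Euc d ≃ₗᵢ[ℝ] Euc d) :=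
  Subgroup.closure (sigma '' (R : Set (Euc d)))

/-- `k` is a parameter function on `R`: it is constant on the orbits of the reflection group in
`R`. (Only the values of `k` on `R` are ever used.) -/
def IsParameterFunction (R : Finset (Euc d)) (k : Euc d → ℂ) : Prop :=
  ∀ g ∈ reflectionGroup R, ∀ α ∈ R, k (g α) = k α

open Classical in
/-- The positive roots `R₊ = {α ∈ R : ⟪α, β⟫ > 0}`. -/
def posRoots (R : Finset (Euc d)) (β : Euc d) : Finset (Euc d) :=
  R.filter fun α => 0 < ⟪α, β⟫_ℝ

/-- The quotient `(f(x) - f(σ_α x)) / ⟪α, x⟫` of a `C¹` function `f`, extended to the hyperplane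
`⟪α, x⟫ = 0` by continuity; its value there is `(2 / ‖α‖²) ∂_α f(x)`. -/
def reflectionQuotient (α : Euc d) (f : Euc d → ℂ) (x : Euc d) : ℂ :=
  if ⟪α, x⟫_ℝ = 0 then ((2 / ‖α‖ ^ 2 : ℝ) : ℂ) * fderiv ℝ f x α
  else (f x - f (sigma α x)) / ((⟪α, x⟫_ℝ : ℝ) : ℂ)

/-- The Dunkl operator `T_ξ(k)`. -/
def dunklOperator (R : Finset (Euc d)) (β : Euc d) (k : Euc d → ℂ) (ξ : Euc d)
    (f : Euc d → ℂ) (x : Euc d) : ℂ :=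
  fderiv ℝ f x ξ +
    ∑ α ∈ posRoots R β, k α * ((⟪α, ξ⟫_ℝ : ℝ) : ℂ) * reflectionQuotient α f x

/-- The function on `ℝ^d` given by a polynomial. -/
def polyFun (p : CPoly d) (x : Euc d) : ℂ := MvPolynomial.eval (toComplex x) p

/-- The directional derivative `∂_ξ` on polynomials. -/
def polyDeriv (ξ : Euc d) (p : CPoly d) : CPoly d :=
  ∑ j, MvPolynomial.C (ξ j : ℂ) * MvPolynomial.pderiv j p

/-- The action `L_g p = p ∘ g` on polynomials. -/
def polyAction (g : Euc d ≃ₗᵢ[ℝ] Euc d) : CPoly d →ₐ[ℂ] CPoly d :=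
  MvPolynomial.aeval fun i =>
    ∑ j, MvPolynomial.C ((g (EuclideanSpace.single j 1) i : ℝ) : ℂ) * MvPolynomial.X j

/-- `polyAction` is composition with `g` on polynomial functions. -/
theorem polyFun_polyAction (g : Euc d ≃ₗᵢ[ℝ] Euc d) (p : CPoly d) (x : Euc d) :
    polyFun (polyAction g p) x = polyFun p (g x) := by
  have hx : x = ∑ j, x j • EuclideanSpace.single j (1 : ℝ) := by
    ext i
    simp [Pi.single_apply]
  have key : ∀ i, ((g x) i : ℂ)
      = ∑ j, ((g (EuclideanSpace.single j 1) i : ℝ) : ℂ) * (x j : ℂ) := by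
    intro i
    conv_lhs => rw [hx]
    simp [map_sum, mul_comm]
  unfold polyFun polyAction
  induction p using MvPolynomial.induction_on with
  | C a => simp
  | add p q hp hq => simp only [map_add, hp, hq]
  | mul_X p i hp =>
    rw [map_mul, map_mul, hp, map_mul]
    simp [toComplex, key]

/-- The number `γ(k) = ∑_{α ∈ R₊} k(α)`. -/
def gammaParam (R : Finset (Euc d)) (β : Euc d) (k : Euc d → ℂ) : ℂ :=
  ∑ α ∈ posRoots R β, k α

/-- The operator `A = ∑_{α ∈ R₊} k(α) L_{σ_α}`. -/
def opA (R : Finset (Euc d)) (β : Euc d) (k : Euc d → ℂ) (p : CPoly d) : CPoly d :=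
  ∑ α ∈ posRoots R β, k α • polyAction (sigma α) p

/-- The operator `W_n = (n + γ) - A`. -/
def opW (R : Finset (Euc d)) (β : Euc d) (k : Euc d → ℂ) (n : ℕ) (p : CPoly d) : CPoly d :=
  ((n : ℂ) + gammaParam R β k) • p - opA R β k p

/-- The set `M^*`: for every `n ≥ 1`, the operator `W_n` is invertible on the space of
homogeneous polynomials of degree `n`. -/
def IsMStar (R : Finset (Euc d)) (β : Euc d) (k : Euc d → ℂ) : Prop :=
  ∀ n : ℕ, 1 ≤ n → Set.BijOn (opW R β k n)
    (MvPolynomial.homogeneousSubmodule (Fin d) ℂ n : Set (CPoly d))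
    (MvPolynomial.homogeneousSubmodule (Fin d) ℂ n : Set (CPoly d))

/-- The characterizing properties of the intertwining operator: `V(P_n) ⊆ P_n`, `V(1) = 1` and
`T_ξ V = V ∂_ξ` for every `ξ`. -/
structure IsIntertwining (R : Finset (Euc d)) (β : Euc d) (k : Euc d → ℂ)
    (V : CPoly d ≃ₗ[ℂ] CPoly d) : Prop where
  map_homogeneous : ∀ (n : ℕ) (p : CPoly d), p.IsHomogeneous n → (V p).IsHomogeneous n
  map_one : V 1 = 1
  intertwines : ∀ (ξ : Euc d) (p : CPoly d) (x : Euc d),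
    dunklOperator R β k ξ (polyFun (V p)) x = polyFun (V (polyDeriv ξ p)) x

open Classical in
/-- The intertwining operator `V_k`: the linear automorphism of the space of polynomials with
the above properties (the identity if there were none). -/
def intertwiningOperator (R : Finset (Euc d)) (β : Euc d) (k : Euc d → ℂ) :
    CPoly d ≃ₗ[ℂ] CPoly d :=
  if h : ∃ V, IsIntertwining R β k V then h.choose else LinearEquiv.refl ℂ (CPoly d)

/-- The linear form `⟨·, y⟩` as a polynomial, for the bilinear extension of the inner product. -/
def linForm (y : Fin d → ℂ) : CPoly d := ∑ j, MvPolynomial.C (y j) * MvPolynomial.X j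

/-- `E_n(x, y) = V_k(⟨·, y⟩ⁿ)(x) / n!`, for `x, y ∈ ℂ^d`. -/
def dunklTerm (R : Finset (Euc d)) (β : Euc d) (k : Euc d → ℂ) (n : ℕ) (x y : Fin d → ℂ) : ℂ :=
  (n.factorial : ℂ)⁻¹ * MvPolynomial.eval x (intertwiningOperator R β k (linForm y ^ n))

/-- The Dunkl kernel `E_k(x, y) = V_k(e^{⟨·, y⟩})(x) = ∑ₙ E_n(x, y)`. -/
def dunklKernel (R : Finset (Euc d)) (β : Euc d) (k : Euc d → ℂ) (x y : Fin d → ℂ) : ℂ :=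
  ∑' n, dunklTerm R β k n x y

/-- The operator `e^{-Δ/2} = ∑ₘ (-1/2)ᵐ Δᵐ / m!` (a finite sum on polynomial functions). -/
def expNegHalfLaplacian (f : Euc d → ℂ) (y : Euc d) : ℂ :=
  ∑' m : ℕ, ((-1 / 2 : ℂ) ^ m / (m.factorial : ℂ)) *
    ((fun h : Euc d → ℂ => Laplacian.laplacian h)^[m] f) y

/-- The term `(e^{-Δ/2} E_n(x, ·))(y)`, for `x ∈ ℂ^d` and `y ∈ ℝ^d`. -/
def lKernelTerm (R : Finset (Euc d)) (β : Euc d) (k : Euc d → ℂ) (n : ℕ)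
    (x : Fin d → ℂ) (y : Euc d) : ℂ :=
  expNegHalfLaplacian (fun z : Euc d => dunklTerm R β k n x (toComplex z)) y

/-- The kernel `L_k(x, y) = ∑ₙ (e^{-Δ/2} E_n(x, ·))(y)`, for `x ∈ ℂ^d` and `y ∈ ℝ^d`. -/
def lKernel (R : Finset (Euc d)) (β : Euc d) (k : Euc d → ℂ) (x : Fin d → ℂ) (y : Euc d) : ℂ :=
  ∑' n, lKernelTerm R β k n x y

/-- The Fourier transform `F(f)(y) = (2π)^{-d/2} ∫ f(z) e^{-i⟨y, z⟩} dz`. -/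
def fourierTransform (f : Euc d → ℂ) (y : Euc d) : ℂ :=
  (((2 * Real.pi) ^ ((d : ℝ) / 2) : ℝ) : ℂ)⁻¹ *
    ∫ z : Euc d, f z * Complex.exp (-Complex.I * ((⟪y, z⟫_ℝ : ℝ) : ℂ))

/-- The Gaussian `e^{-‖z‖²/2}`. -/
def gaussian (z : Euc d) : ℂ := ((Real.exp (-‖z‖ ^ 2 / 2) : ℝ) : ℂ)

end

end DunklTheory

namespace DunklTheory

open MeasureTheory

noncomputable section

variable {d : ℕ}

/-! ### Calculus of polynomial functions -/

/-! For a single polynomial the formula is classical: the transform of `e^{-‖z‖²/2} p(iz)` is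
`e^{-‖y‖²/2} (e^{-Δ/2} p)(y)` (`fourierTransform_gaussian_mul_polyFun`). It follows by induction on
multiplication by a coordinate. Under the transform, multiplication by `z_j` becomes `i∂_j`, and
`∂_j` of a Gaussian times `q` is the Gaussian times `∂_j q - y_j q`. This matches the commutation
rule `e^{-Δ/2}(p X_j) = (X_j - ∂_j) e^{-Δ/2} p`. Since `E_n` is homogeneous of degree `n` in each
variable, `E_n(ix, z) = E_n(x, iz)`, so the identity of the theorem holds term by term.

Summing over `n` needs a bound `‖E_n(x, z)‖ ≤ C (ρ‖z‖)ⁿ / n!`. No positivity of `k` is available, so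
it comes from the recursion `W_{n+1} V(ℓ^{n+1}) = (n+1) ℓ V(ℓⁿ)` for linear forms `ℓ`
(`IsIntertwining.opW_linForm_pow`). On sup norms over reflection-invariant balls, `W_n` is bounded
below by `n/2` once `n` is large (`norm_eval_le_of_opW`), so `V(ℓⁿ)` grows at most geometrically.
Dominated convergence then exchanges sum and integral.

Since `intertwiningOperator` is obtained by choice, its existence must be proved. Its inverse `S` is
built degree by degree from `S p = n⁻¹ ∑ x_j S(T_j p)`. Commutativity of the Dunkl operators gives
`∂_ξ S = S T_ξ`, invertibility of the `W_n` gives injectivity, and finite dimension of each degree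
gives surjectivity. -/

theorem polyFun_C (a : ℂ) : polyFun (MvPolynomial.C a : CPoly d) = fun _ => a := by
  funext z; simp [polyFun]

theorem polyFun_add (p q : CPoly d) : polyFun (p + q) = fun z => polyFun p z + polyFun q z := by
  funext z; simp [polyFun]

theorem polyFun_mul_X (p : CPoly d) (i : Fin d) :
    polyFun (p * MvPolynomial.X i) = fun z => polyFun p z * ((z i : ℝ) : ℂ) := by
  funext z; simp [polyFun, toComplex]

/-- The commutator of two derivations is a derivation, and this one kills every variable. -/
theorem pderiv_comm (i j : Fin d) (p : CPoly d) :
    MvPolynomial.pderiv i (MvPolynomial.pderiv j p) =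
      MvPolynomial.pderiv j (MvPolynomial.pderiv i p) := by
  have h : ⁅(MvPolynomial.pderiv i : Derivation ℂ (CPoly d) (CPoly d)), MvPolynomial.pderiv (R := ℂ) j⁆ =
      0 := by
    refine MvPolynomial.derivation_ext fun l => ?_
    simp only [Derivation.commutator_apply, MvPolynomial.pderiv_X, Derivation.zero_apply]
    by_cases hi : l = i <;> by_cases hj : l = j <;> simp [Pi.single_apply, hi, hj, apply_ite]
  have := congrArg (fun D => D p) h
  simpa [Derivation.commutator_apply, sub_eq_zero] using this

theorem hasFDerivAt_polyFun (p : CPoly d) (x : Euc d) :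
    HasFDerivAt (polyFun p)
      (∑ j, polyFun (MvPolynomial.pderiv j p) x •
        (Complex.ofRealCLM ∘L (EuclideanSpace.proj j : Euc d →L[ℝ] ℝ))) x := by
  induction p using MvPolynomial.induction_on with
  | C a => 
    rw [polyFun_C]
    refine (hasFDerivAt_const a x).congr_fderiv ?_
    ext v
    simp [polyFun]
  | add p q hp hq =>
    have h := hp.add hq
    rw [← Finset.sum_add_distrib] at h
    simp only [← add_smul] at h
    rw [polyFun_add]
    simpa [polyFun, Pi.add_def] using h
  | mul_X p i hp =>
    have hX : HasFDerivAt (fun z : Euc d => ((z i : ℝ) : ℂ))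
        (Complex.ofRealCLM ∘L (EuclideanSpace.proj i : Euc d →L[ℝ] ℝ)) x :=
      (Complex.ofRealCLM ∘L (EuclideanSpace.proj i : Euc d →L[ℝ] ℝ)).hasFDerivAt
    have h := hp.mul hX
    rw [polyFun_mul_X]
    refine h.congr_fderiv ?_
    ext v
    simp [polyFun, toComplex, MvPolynomial.pderiv_X, Pi.single_apply, Finset.sum_add_distrib,
      add_mul, apply_ite, Finset.mul_sum]
    exact Finset.sum_congr rfl fun _ _ => by ring

theorem fderiv_polyFun_apply (p : CPoly d) (x v : Euc d) :
    fderiv ℝ (polyFun p) x v = ∑ j, (v j : ℂ) * polyFun (MvPolynomial.pderiv j p) x := by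
  rw [(hasFDerivAt_polyFun p x).fderiv]
  simp [mul_comm]

theorem fderiv_polyFun (p : CPoly d) (x v : Euc d) :
    fderiv ℝ (polyFun p) x v = polyFun (polyDeriv v p) x := by
  rw [fderiv_polyFun_apply]
  simp [polyFun, polyDeriv]

theorem differentiable_polyFun (p : CPoly d) : Differentiable ℝ (polyFun p) :=
  fun x => (hasFDerivAt_polyFun p x).differentiableAt

theorem continuous_polyFun (p : CPoly d) : Continuous (polyFun p) :=
  (differentiable_polyFun p).continuous

theorem contDiff_polyFun (p : CPoly d) : ContDiff ℝ 2 (polyFun p) := by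
  induction p using MvPolynomial.induction_on with
  | C a => 
    rw [polyFun_C]
    exact contDiff_const
  | add p q hp hq =>
    rw [polyFun_add]
    exact hp.add hq
  | mul_X p i hp =>
    rw [polyFun_mul_X]
    exact hp.mul (Complex.ofRealCLM ∘L (EuclideanSpace.proj i : Euc d →L[ℝ] ℝ)).contDiff

/-! ### Powers of the Laplacian and truncations of `e^{-Δ/2}`. -/

/-- The Laplacian on polynomials. -/
def polyLaplacian : CPoly d →ₗ[ℂ] CPoly d :=
  ∑ j, (MvPolynomial.pderiv j).toLinearMap ∘ₗ (MvPolynomial.pderiv j).toLinearMap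

theorem polyLaplacian_apply (p : CPoly d) :
    polyLaplacian p = ∑ j, MvPolynomial.pderiv j (MvPolynomial.pderiv j p) := by
  simp [polyLaplacian]

theorem laplacian_polyFun (p : CPoly d) :
    Laplacian.laplacian (polyFun p) = polyFun (polyLaplacian p) := by
  funext x
  rw [InnerProductSpace.laplacian_eq_iteratedFDeriv_orthonormalBasis (polyFun p)
    (EuclideanSpace.basisFun (Fin d) ℝ), polyLaplacian_apply]
  simp only [polyFun, map_sum]
  refine Finset.sum_congr rfl fun j _ => ?_
  rw [iteratedFDeriv_two_apply]
  have hd : DifferentiableAt ℝ (fderiv ℝ (polyFun p)) x :=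
    ((contDiff_polyFun p).fderiv_right (m := 1) le_rfl).differentiable one_ne_zero x
  have e : (fun z => fderiv ℝ (polyFun p) z (EuclideanSpace.single j 1)) =
      polyFun (MvPolynomial.pderiv j p) := by
    funext z
    rw [fderiv_polyFun_apply]
    simp [apply_ite]
  have h2 := (hd.hasFDerivAt.clm_apply
    (hasFDerivAt_const (EuclideanSpace.single j (1 : ℝ)) x)).fderiv
  rw [e] at h2
  have h3 := congrArg (fun L => L (EuclideanSpace.single j (1 : ℝ))) h2
  simp only [fderiv_polyFun_apply] at h3
  simp [apply_ite] at h3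
  simpa [polyFun] using h3.symm

theorem iterate_laplacian_polyFun (m : ℕ) (p : CPoly d) :
    ((fun h : Euc d → ℂ => Laplacian.laplacian h)^[m] (polyFun p)) =
      polyFun ((polyLaplacian ^ m) p) := by
  induction m generalizing p with
  | zero => rfl
  | succ m ih => rw [Function.iterate_succ_apply, laplacian_polyFun, ih, pow_succ]; rfl

/-- The partial sums of `e^{-Δ/2}` on polynomials. -/
def expPartial (N : ℕ) : CPoly d →ₗ[ℂ] CPoly d :=
  ∑ m ∈ Finset.range N, ((-1 / 2 : ℂ) ^ m / (m.factorial : ℂ)) • polyLaplacian ^ m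

theorem polyLaplacian_mul_X (p : CPoly d) (j : Fin d) :
    polyLaplacian (p * MvPolynomial.X j) =
      polyLaplacian p * MvPolynomial.X j + 2 * MvPolynomial.pderiv j p := by
  have h : ∀ i : Fin d, MvPolynomial.pderiv i (MvPolynomial.pderiv i (p * MvPolynomial.X j)) =
      MvPolynomial.pderiv i (MvPolynomial.pderiv i p) * MvPolynomial.X j +
        if i = j then 2 * MvPolynomial.pderiv j p else 0 := by
    intro i
    by_cases hij : i = j
    · subst hij
      simp
      ring
    · simp [MvPolynomial.pderiv_X_of_ne (Ne.symm hij), hij]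
      ring
  simp only [polyLaplacian_apply, h, Finset.sum_add_distrib, Finset.sum_mul]
  simp

theorem pderiv_polyLaplacian (p : CPoly d) (j : Fin d) :
    MvPolynomial.pderiv j (polyLaplacian p) = polyLaplacian (MvPolynomial.pderiv j p) := by
  simp only [polyLaplacian_apply, map_sum]
  refine Finset.sum_congr rfl fun i _ => ?_
  rw [pderiv_comm j, pderiv_comm j]

theorem polyLaplacian_pow_mul_X (m : ℕ) (p : CPoly d) (j : Fin d) :
    (polyLaplacian ^ (m + 1)) (p * MvPolynomial.X j) =
      (polyLaplacian ^ (m + 1)) p * MvPolynomial.X j +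
        (2 * (m + 1) : ℂ) • MvPolynomial.pderiv j ((polyLaplacian ^ m) p) := by
  induction m with
  | zero =>
    have h2 : (2 : CPoly d) = MvPolynomial.C 2 := (map_ofNat _ 2).symm
    simp [polyLaplacian_mul_X, MvPolynomial.smul_eq_C_mul, h2]
  | succ m ih =>
    rw [pow_succ', Module.End.mul_apply, ih, map_add, polyLaplacian_mul_X, map_smul,
      ← pderiv_polyLaplacian, ← Module.End.mul_apply, ← pow_succ', ← Module.End.mul_apply,
      ← pow_succ', add_assoc]
    congr 1
    simp only [MvPolynomial.smul_eq_C_mul]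
    push_cast
    simp only [map_mul, map_add, map_one, map_ofNat]
    ring

/-- Here `[Δ^{m+1}, X_j] = 2(m+1) ∂_j Δ^m`, and `2(m+1)` times the coefficient of index `m+1` is
minus the coefficient of index `m`. This shift of index is why the derivative term carries the
truncation `N` instead of `N + 1`. -/
theorem expPartial_mul_X (N : ℕ) (p : CPoly d) (j : Fin d) :
    expPartial (N + 1) (p * MvPolynomial.X j) =
      expPartial (N + 1) p * MvPolynomial.X j - MvPolynomial.pderiv j (expPartial N p) := by
  simp only [expPartial, LinearMap.sum_apply, LinearMap.smul_apply]
  rw [Finset.sum_range_succ', Finset.sum_range_succ' _ N]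
  simp only [polyLaplacian_pow_mul_X, smul_add, Finset.sum_add_distrib, add_mul, Finset.sum_mul,
    map_sum, sub_eq_add_neg, ← Finset.sum_neg_distrib]
  have : ∀ m ∈ Finset.range N, ((-1 / 2 : ℂ) ^ (m + 1) / ((m + 1).factorial : ℂ)) •
      (2 * (m + 1) : ℂ) • MvPolynomial.pderiv j ((polyLaplacian ^ m) p) =
      -MvPolynomial.pderiv j (((-1 / 2 : ℂ) ^ m / (m.factorial : ℂ)) • (polyLaplacian ^ m) p) := by
    intro m _
    rw [smul_smul, (MvPolynomial.pderiv j).map_smul, ← neg_smul]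
    congr 1
    rw [Nat.factorial_succ]
    have h1 : ((m : ℂ) + 1) ≠ 0 := by exact_mod_cast Nat.succ_ne_zero m
    have h2 : (m.factorial : ℂ) ≠ 0 := by exact_mod_cast m.factorial_ne_zero
    push_cast
    field_simp
    ring
  rw [Finset.sum_congr rfl this]
  simp only [smul_mul_assoc]
  simp
  ring

/-- The powers of the Laplacian vanish eventually on each polynomial. -/
theorem exists_polyLaplacian_pow_eq_zero (p : CPoly d) :
    ∃ N, ∀ m, N ≤ m → (polyLaplacian ^ m) p = 0 := by
  induction p using MvPolynomial.induction_on with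
  | C a =>
    refine ⟨1, fun m hm => ?_⟩
    obtain ⟨m, rfl⟩ := Nat.exists_eq_add_of_le' hm
    rw [pow_succ, Module.End.mul_apply, polyLaplacian_apply]
    simp
  | add p q hp hq =>
    obtain ⟨N, hN⟩ := hp
    obtain ⟨M, hM⟩ := hq
    refine ⟨max N M, fun m hm => ?_⟩
    rw [map_add, hN m (le_trans (le_max_left _ _) hm), hM m (le_trans (le_max_right _ _) hm),
      add_zero]
  | mul_X p i hp =>
    obtain ⟨N, hN⟩ := hp
    refine ⟨N + 1, fun m hm => ?_⟩
    obtain ⟨m, rfl⟩ := Nat.exists_eq_add_of_le' (le_trans (Nat.le_add_left 1 N) hm)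
    rw [polyLaplacian_pow_mul_X, hN (m + 1) (by omega), hN m (by omega)]
    simp

theorem expNegHalfLaplacian_polyFun {p : CPoly d} {N : ℕ}
    (hN : ∀ m, N ≤ m → (polyLaplacian ^ m) p = 0) (y : Euc d) :
    expNegHalfLaplacian (polyFun p) y = polyFun (expPartial N p) y := by
  unfold expNegHalfLaplacian
  simp only [iterate_laplacian_polyFun]
  rw [tsum_eq_sum (s := Finset.range N)]
  · simp [expPartial, polyFun]
  · intro m hm
    rw [hN m (by simpa using hm)]
    simp [polyFun]

/-! ### Gaussian integrals of polynomials -/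

theorem continuous_gaussian : Continuous (gaussian : Euc d → ℂ) := by
  unfold gaussian
  fun_prop

theorem norm_gaussian (z : Euc d) : ‖gaussian z‖ = Real.exp (-‖z‖ ^ 2 / 2) := by
  rw [gaussian, Complex.norm_real, Real.norm_of_nonneg (Real.exp_pos _).le]

theorem integrable_gaussian_mul_exp_norm (ρ : ℝ) :
    Integrable (fun z : Euc d => Real.exp (-‖z‖ ^ 2 / 2) * Real.exp (ρ * ‖z‖)) := by
  have h0 : Integrable (fun z : Euc d =>
      Complex.exp (-(1 / 4 : ℂ) * ‖z‖ ^ 2 + 0 * ((⟪(0 : Euc d), z⟫_ℝ : ℝ) : ℂ))) :=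
    GaussianFourier.integrable_cexp_neg_mul_sq_norm_add (by norm_num) 0 0
  refine (h0.norm.const_mul (Real.exp (ρ ^ 2))).mono' (by fun_prop) (ae_of_all _ fun z => ?_)
  rw [Real.norm_of_nonneg (by positivity), Complex.norm_exp, ← Real.exp_add, ← Real.exp_add]
  refine Real.exp_le_exp.mpr ?_
  have : (-(1 / 4 : ℂ) * ‖z‖ ^ 2 + 0 * ((⟪(0 : Euc d), z⟫_ℝ : ℝ) : ℂ)).re = -(1 / 4) * ‖z‖ ^ 2 := by
    have h1 : (-(1 / 4 : ℂ) * ‖z‖ ^ 2) = ((-(1 / 4) * ‖z‖ ^ 2 : ℝ) : ℂ) := by push_cast; ring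
    rw [zero_mul, add_zero, h1, Complex.ofReal_re]
  rw [this]
  -- The inequality `ρt ≤ ρ² + t²/4` leaves the Gaussian `e^{-‖z‖²/4}` with the constant `e^{ρ²}`.
  nlinarith [sq_nonneg (‖z‖ / 2 - ρ)]

theorem norm_apply_le (z : Euc d) (i : Fin d) : ‖((z i : ℝ) : ℂ)‖ ≤ ‖z‖ := by
  rw [Complex.norm_real]
  exact PiLp.norm_apply_le z i

theorem exists_norm_polyFun_le (p : CPoly d) :
    ∃ C ρ : ℝ, 0 ≤ C ∧ ∀ z : Euc d, ‖polyFun p z‖ ≤ C * Real.exp (ρ * ‖z‖) := by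
  induction p using MvPolynomial.induction_on with
  | C a => exact ⟨‖a‖, 0, norm_nonneg a, fun z => by simp [polyFun]⟩
  | add p q hp hq =>
    obtain ⟨C, ρ, hC, h⟩ := hp
    obtain ⟨D, τ, hD, h'⟩ := hq
    refine ⟨C + D, max ρ τ, add_nonneg hC hD, fun z => ?_⟩
    rw [polyFun_add, add_mul]
    refine (norm_add_le _ _).trans (add_le_add ((h z).trans ?_) ((h' z).trans ?_)) <;> gcongr
    exacts [le_max_left _ _, le_max_right _ _]
  | mul_X p i hp =>
    obtain ⟨C, ρ, hC, h⟩ := hp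
    -- The new factor satisfies `|z_i| ≤ ‖z‖ ≤ e^{‖z‖}`, which raises the rate by one.
    refine ⟨C, ρ + 1, hC, fun z => ?_⟩
    rw [polyFun_mul_X, norm_mul, add_mul, one_mul, Real.exp_add, ← mul_assoc]
    refine mul_le_mul (h z) ((norm_apply_le z i).trans ?_) (norm_nonneg _) (by positivity)
    linarith [Real.add_one_le_exp ‖z‖]

theorem integrable_gaussian_mul_polyFun (p : CPoly d) :
    Integrable (fun z : Euc d => gaussian z * polyFun p z) := by
  obtain ⟨C, ρ, hC, h⟩ := exists_norm_polyFun_le p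
  refine ((integrable_gaussian_mul_exp_norm (d := d) ρ).const_mul C).mono'
    (continuous_gaussian.mul (continuous_polyFun p)).aestronglyMeasurable (ae_of_all _ fun z => ?_)
  rw [norm_mul, norm_gaussian, mul_left_comm]
  gcongr
  exact h z

/-! ### Fourier transforms and multiplication by coordinates. -/

theorem norm_exp_neg_I_mul (t : ℝ) : ‖Complex.exp (-Complex.I * (t : ℂ))‖ = 1 := by
  rw [Complex.norm_exp]
  simp

theorem integrable_mul_exp_neg_I {f : Euc d → ℂ} (hf : Integrable f) (y : Euc d) :
    Integrable (fun z => f z * Complex.exp (-Complex.I * ((⟪y, z⟫_ℝ : ℝ) : ℂ))) := by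
  refine hf.norm.mono' (hf.aestronglyMeasurable.mul (by fun_prop)) (ae_of_all _ fun z => ?_)
  rw [norm_mul, norm_exp_neg_I_mul, mul_one]

/-- The partial derivatives of a Fourier transform. -/
theorem hasDerivAt_fourierTransform {f : Euc d → ℂ} (hf : Integrable f) (j : Fin d)
    (hf' : Integrable fun z => f z * ((z j : ℝ) : ℂ)) (y : Euc d) :
    HasDerivAt (fun t : ℝ => fourierTransform f (y + t • EuclideanSpace.single j (1 : ℝ)))
      (-Complex.I * fourierTransform (fun z => f z * ((z j : ℝ) : ℂ)) y) 0 := by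
  have key := hasDerivAt_integral_of_dominated_loc_of_deriv_le (μ := volume)
    (F := fun (t : ℝ) (z : Euc d) => f z * Complex.exp (-Complex.I *
      ((⟪y + t • EuclideanSpace.single j (1 : ℝ), z⟫_ℝ : ℝ) : ℂ)))
    (F' := fun (t : ℝ) (z : Euc d) => -Complex.I * (f z * ((z j : ℝ) : ℂ) *
      Complex.exp (-Complex.I * ((⟪y + t • EuclideanSpace.single j (1 : ℝ), z⟫_ℝ : ℝ) : ℂ))))
    (x₀ := 0) (s := Set.univ) (bound := fun z => ‖f z * ((z j : ℝ) : ℂ)‖) Filter.univ_mem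
    (Filter.Eventually.of_forall fun t =>
      (integrable_mul_exp_neg_I hf _).aestronglyMeasurable)
    (integrable_mul_exp_neg_I hf _)
    ((integrable_mul_exp_neg_I hf' _).const_mul _).aestronglyMeasurable
    (ae_of_all _ fun z t _ => by
      rw [norm_mul, norm_mul, norm_exp_neg_I_mul]
      simp) hf'.norm
    (ae_of_all _ fun z t _ => by
      have h1 : HasDerivAt (fun t : ℝ =>
          ((⟪y + t • EuclideanSpace.single j (1 : ℝ), z⟫_ℝ : ℝ) : ℂ)) ((z j : ℝ) : ℂ) t := by
        refine HasDerivAt.ofReal_comp ?_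
        have : (fun t : ℝ => ⟪y + t • EuclideanSpace.single j (1 : ℝ), z⟫_ℝ) =
            fun t => ⟪y, z⟫_ℝ + t * z j := by
          funext t
          rw [inner_add_left, inner_smul_left, EuclideanSpace.inner_single_left]
          simp
        rw [this]
        simpa using ((hasDerivAt_id t).mul_const (z j)).const_add ⟪y, z⟫_ℝ
      refine (((h1.const_mul (-Complex.I)).cexp).const_mul (f z)).congr_deriv ?_
      ring)
  have h := (key.2).const_mul ((((2 * Real.pi) ^ ((d : ℝ) / 2) : ℝ) : ℂ)⁻¹)
  refine h.congr_deriv ?_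
  rw [integral_const_mul, fourierTransform]
  simp only [zero_smul, add_zero]
  ring

theorem hasDerivAt_gaussian (j : Fin d) (y : Euc d) :
    HasDerivAt (fun t : ℝ => gaussian (y + t • EuclideanSpace.single j (1 : ℝ)))
      (-((y j : ℝ) : ℂ) * gaussian y) 0 := by
  have hl : HasDerivAt (fun t : ℝ => y + t • EuclideanSpace.single j (1 : ℝ))
      (EuclideanSpace.single j (1 : ℝ)) 0 := by
    simpa using ((hasDerivAt_id (0 : ℝ)).smul_const (EuclideanSpace.single j (1 : ℝ))).const_add y
  have h1 := hl.norm_sq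
  have h2 := (((h1.neg).div_const 2).exp).ofReal_comp
  refine h2.congr_deriv ?_
  simp [gaussian, EuclideanSpace.inner_single_right]
  ring

theorem hasDerivAt_polyFun (p : CPoly d) (j : Fin d) (y : Euc d) :
    HasDerivAt (fun t : ℝ => polyFun p (y + t • EuclideanSpace.single j (1 : ℝ)))
      (polyFun (MvPolynomial.pderiv j p) y) 0 := by
  have hl : HasDerivAt (fun t : ℝ => y + t • EuclideanSpace.single j (1 : ℝ))
      (EuclideanSpace.single j (1 : ℝ)) 0 := by
    simpa using ((hasDerivAt_id (0 : ℝ)).smul_const (EuclideanSpace.single j (1 : ℝ))).const_add y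
  have h := ((differentiable_polyFun p) (y + (0 : ℝ) • EuclideanSpace.single j (1 : ℝ))
    |>.hasFDerivAt).comp_hasDerivAt (0 : ℝ) hl
  refine h.congr_deriv ?_
  rw [fderiv_polyFun_apply]
  simp [apply_ite]

theorem fourierTransform_gaussian (y : Euc d) :
    fourierTransform (fun z => gaussian z) y = gaussian y := by
  have h := GaussianFourier.integral_cexp_neg_mul_sq_norm_add (b := (1 / 2 : ℂ)) (by norm_num)
    (-Complex.I) y
  have e : ∀ z : Euc d, gaussian z * Complex.exp (-Complex.I * ((⟪y, z⟫_ℝ : ℝ) : ℂ)) =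
      Complex.exp (-(1 / 2 : ℂ) * ‖z‖ ^ 2 + -Complex.I * ((⟪y, z⟫_ℝ : ℝ) : ℂ)) := by
    intro z
    rw [Complex.exp_add, gaussian]
    congr 1
    push_cast
    congr 1
    ring
  rw [fourierTransform]
  simp only [e]
  rw [h]
  have h1 : ((Real.pi : ℂ) / (1 / 2)) ^ ((Module.finrank ℝ (Euc d) : ℂ) / 2) =
      (((2 * Real.pi) ^ ((d : ℝ) / 2) : ℝ) : ℂ) := by
    rw [Complex.ofReal_cpow (by positivity)]
    push_cast
    rw [finrank_euclideanSpace_fin]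
    congr 1
    ring
  rw [h1, inv_mul_cancel_left₀]
  · rw [gaussian]
    push_cast
    congr 1
    simp
    ring
  · exact_mod_cast (Real.rpow_pos_of_pos (by positivity) _).ne'

/-- The substitution `p ↦ p(i ·)`. -/
def polyScaleI : CPoly d →ₐ[ℂ] CPoly d :=
  MvPolynomial.aeval fun j => MvPolynomial.C Complex.I * MvPolynomial.X j

theorem polyFun_polyScaleI (p : CPoly d) (z : Euc d) :
    polyFun (polyScaleI p) z = MvPolynomial.eval (Complex.I • toComplex z) p := by
  unfold polyFun polyScaleI
  induction p using MvPolynomial.induction_on with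
  | C a => simp
  | add p q hp hq => simp only [map_add, hp, hq]
  | mul_X p i hp =>
    rw [map_mul, map_mul, hp, map_mul]
    simp

theorem fourierTransform_add {f g : Euc d → ℂ} (hf : Integrable f) (hg : Integrable g)
    (y : Euc d) :
    fourierTransform (fun z => f z + g z) y = fourierTransform f y + fourierTransform g y := by
  simp only [fourierTransform, add_mul]
  rw [integral_add (integrable_mul_exp_neg_I hf y) (integrable_mul_exp_neg_I hg y), mul_add]

theorem fourierTransform_const_mul (c : ℂ) (f : Euc d → ℂ) (y : Euc d) :
    fourierTransform (fun z => c * f z) y = c * fourierTransform f y := by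
  simp only [fourierTransform, mul_assoc]
  rw [integral_const_mul]
  ring

/-- The Fourier transform of a Gaussian times a polynomial is a Gaussian times the
corresponding Hermite type polynomial. -/
theorem fourierTransform_gaussian_mul_polyFun (p : CPoly d) :
    ∃ N, ∀ M, N ≤ M → ∀ y : Euc d,
      fourierTransform (fun z => gaussian z * polyFun (polyScaleI p) z) y =
        gaussian y * polyFun (expPartial M p) y := by
  induction p using MvPolynomial.induction_on with
  | C a =>
    refine ⟨1, fun M hM y => ?_⟩
    obtain ⟨M, rfl⟩ := Nat.exists_eq_add_of_le' hM
    have h1 : expPartial (M + 1) (MvPolynomial.C a : CPoly d) = MvPolynomial.C a := by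
      rw [expPartial, LinearMap.sum_apply, Finset.sum_eq_single_of_mem 0 (by simp)]
      · simp
      · intro m _ hm
        obtain ⟨m, rfl⟩ := Nat.exists_eq_succ_of_ne_zero hm
        rw [LinearMap.smul_apply, pow_succ polyLaplacian, Module.End.mul_apply, polyLaplacian_apply]
        simp
    have h2 : polyScaleI (MvPolynomial.C a : CPoly d) = MvPolynomial.C a := by
      simp [polyScaleI]
    rw [h1, h2, polyFun_C, mul_comm, ← fourierTransform_gaussian y,
      ← fourierTransform_const_mul]
    simp only [mul_comm]
  | add p q hp hq =>
    obtain ⟨N, hN⟩ := hp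
    obtain ⟨K, hK⟩ := hq
    refine ⟨max N K, fun M hM y => ?_⟩
    rw [map_add, map_add, polyFun_add, polyFun_add, mul_add,
      ← hN M ((le_max_left _ _).trans hM) y, ← hK M ((le_max_right _ _).trans hM) y,
      ← fourierTransform_add (integrable_gaussian_mul_polyFun _)
        (integrable_gaussian_mul_polyFun _)]
    simp only [mul_add]
  | mul_X p j hp =>
    obtain ⟨N, hN⟩ := hp
    refine ⟨N + 1, fun M hM y => ?_⟩
    -- Two truncations of `e^{-Δ/2} p` occur below, of lengths `M` and `M + 1`. Both are long enough
    -- for the induction hypothesis.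
    obtain ⟨M, rfl⟩ := Nat.exists_eq_add_of_le' (le_trans (Nat.le_add_left 1 N) hM)
    have hN1 := hN (M + 1) (by omega)
    have hN0 := hN M (by omega)
    have hi := integrable_gaussian_mul_polyFun (polyScaleI p)
    have hi' : Integrable fun z : Euc d =>
        gaussian z * polyFun (polyScaleI p) z * ((z j : ℝ) : ℂ) := by
      have := integrable_gaussian_mul_polyFun (polyScaleI p * MvPolynomial.X j)
      simpa only [polyFun_mul_X, mul_assoc] using this
    have hL := hasDerivAt_fourierTransform hi j hi' y
    simp only [hN0] at hL
    have hR := (hasDerivAt_gaussian j y).mul (hasDerivAt_polyFun (expPartial M p) j y)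
    -- The `j`-th partial derivative of the transform at `y` is computed twice: under the integral
    -- sign, and by the product rule on its closed form.
    have heq := hL.unique hR
    simp only [zero_smul, add_zero] at heq
    have e : (fun z : Euc d => gaussian z * polyFun (polyScaleI (p * MvPolynomial.X j)) z) =
        fun z => Complex.I * (gaussian z * polyFun (polyScaleI p) z * ((z j : ℝ) : ℂ)) := by
      funext z
      have : polyScaleI (p * MvPolynomial.X j) =
          polyScaleI p * (MvPolynomial.C Complex.I * MvPolynomial.X j) := by
        simp [polyScaleI]
      rw [this]
      simp [polyFun, toComplex]
      ring
    -- Both truncations give the same Fourier transform, so they agree without comparing their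
    -- terms.
    have hEE : gaussian y * polyFun (expPartial M p) y =
        gaussian y * polyFun (expPartial (M + 1) p) y := by rw [← hN0, ← hN1]
    rw [e, fourierTransform_const_mul, expPartial_mul_X, sub_eq_add_neg, polyFun_add,
      polyFun_mul_X]
    have hneg : polyFun (-(MvPolynomial.pderiv j) ((expPartial M) p)) y =
        -polyFun ((MvPolynomial.pderiv j) ((expPartial M) p)) y := by simp [polyFun]
    beta_reduce
    rw [hneg]
    linear_combination (-1 : ℂ) * heq + ((y j : ℝ) : ℂ) * hEE

/-! ### Growth of the intertwining operator on powers of linear forms -/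

/-- The point `a + i b` of `ℂ^d`. -/
def complexPoint (a b : Euc d) : Fin d → ℂ := toComplex a + Complex.I • toComplex b

theorem exists_eq_complexPoint (x : Fin d → ℂ) : ∃ a b : Euc d, x = complexPoint a b := by
  refine ⟨WithLp.toLp 2 fun i => (x i).re, WithLp.toLp 2 fun i => (x i).im, ?_⟩
  funext i
  simp [complexPoint, toComplex, mul_comm Complex.I, Complex.re_add_im]

theorem toComplex_map (g : Euc d ≃ₗᵢ[ℝ] Euc d) (x : Euc d) (i : Fin d) :
    toComplex (g x) i =
      ∑ j, ((g (EuclideanSpace.single j 1) i : ℝ) : ℂ) * toComplex x j := by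
  have h := polyFun_polyAction g (MvPolynomial.X i) x
  simp only [polyFun, polyAction, MvPolynomial.aeval_X, MvPolynomial.eval_X, map_sum, map_mul,
    MvPolynomial.eval_C] at h
  exact h.symm

/-- A real isometry extended complex-linearly acts separately on real and imaginary parts. Products
of balls in `(a, b)` are therefore invariant compact sets in `ℂ^d`. -/
theorem eval_complexPoint_polyAction (g : Euc d ≃ₗᵢ[ℝ] Euc d) (p : CPoly d) (a b : Euc d) :
    MvPolynomial.eval (complexPoint a b) (polyAction g p) =
      MvPolynomial.eval (complexPoint (g a) (g b)) p := by
  unfold polyAction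
  induction p using MvPolynomial.induction_on with
  | C a => simp
  | add p q hp hq => simp only [map_add, hp, hq]
  | mul_X p i hp =>
    rw [map_mul, map_mul, hp, map_mul]
    congr 1
    simp only [MvPolynomial.aeval_X, map_sum, map_mul, MvPolynomial.eval_C, MvPolynomial.eval_X,
      complexPoint, Pi.add_apply, Pi.smul_apply, toComplex_map, smul_eq_mul, Finset.mul_sum]
    rw [← Finset.sum_add_distrib]
    exact Finset.sum_congr rfl fun j _ => by ring

theorem continuous_eval_complexPoint (p : CPoly d) :
    Continuous fun ab : Euc d × Euc d => MvPolynomial.eval (complexPoint ab.1 ab.2) p := by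
  have h : Continuous fun ab : Euc d × Euc d => complexPoint ab.1 ab.2 := by
    unfold complexPoint toComplex
    fun_prop
  exact (MvPolynomial.continuous_eval p).comp h

/-- Polynomials are determined by their values on `ℝ^d`. -/
theorem polyFun_injective : Function.Injective (polyFun : CPoly d → Euc d → ℂ) := by
  intro p q h
  refine MvPolynomial.funext_set (fun _ => Set.range ((↑) : ℝ → ℂ))
    (fun _ => Set.infinite_range_of_injective Complex.ofReal_injective) fun x hx => ?_
  choose y hy using fun i => hx i (Set.mem_univ i)
  have : x = toComplex (WithLp.toLp 2 y : Euc d) := by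
    funext i
    simp [toComplex, hy]
  rw [this]
  exact congrFun h _

theorem IsHomogeneous.fderiv_polyFun_self {q : CPoly d} {n : ℕ} (hq : q.IsHomogeneous n)
    (x : Euc d) : fderiv ℝ (polyFun q) x x = n * polyFun q x := by
  rw [fderiv_polyFun_apply]
  have h := congrArg (fun p => polyFun p x) hq.sum_X_mul_pderiv
  simpa [polyFun, toComplex] using h

/-- On the hyperplane both sides vanish, so the value assigned there to the quotient plays no role.
-/
theorem inner_mul_reflectionQuotient (α : Euc d) (f : Euc d → ℂ) (x : Euc d) :
    ((⟪α, x⟫_ℝ : ℝ) : ℂ) * reflectionQuotient α f x = f x - f (sigma α x) := by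
  unfold reflectionQuotient
  split_ifs with h
  · have : sigma α x = x := by
      rw [sigma_apply, real_inner_comm, h]
      simp
    rw [this, h]
    simp
  · rw [mul_div_cancel₀]
    exact_mod_cast h

theorem polyFun_opW (R : Finset (Euc d)) (β : Euc d) (k : Euc d → ℂ) (n : ℕ) (p : CPoly d)
    (x : Euc d) :
    polyFun (opW R β k n p) x =
      n * polyFun p x + ∑ α ∈ posRoots R β, k α * (polyFun p x - polyFun p (sigma α x)) := by
  have h : ∀ α, polyFun p (sigma α x) = MvPolynomial.eval (toComplex x) (polyAction (sigma α) p) :=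
    fun α => (polyFun_polyAction (sigma α) p x).symm
  simp only [h]
  simp [polyFun, opW, opA, gammaParam, mul_sub, Finset.sum_mul, add_mul]
  ring

/-- The Euler type identity `∑ⱼ xⱼ Tⱼ = W_n` on homogeneous polynomials of degree `n`. -/
theorem dunklOperator_self (R : Finset (Euc d)) (β : Euc d) (k : Euc d → ℂ) {n : ℕ} {p : CPoly d}
    (hp : p.IsHomogeneous n) (x : Euc d) :
    dunklOperator R β k x (polyFun p) x = polyFun (opW R β k n p) x := by
  rw [polyFun_opW, dunklOperator, IsHomogeneous.fderiv_polyFun_self hp]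
  simp only [mul_assoc, inner_mul_reflectionQuotient]

theorem isHomogeneous_linForm (w : Fin d → ℂ) : (linForm w).IsHomogeneous 1 :=
  MvPolynomial.IsHomogeneous.sum _ _ _ fun j _ => by
    simpa using (MvPolynomial.isHomogeneous_C (Fin d) (w j)).mul (MvPolynomial.isHomogeneous_X ℂ j)

theorem isHomogeneous_linForm_pow (w : Fin d → ℂ) (n : ℕ) :
    (linForm w ^ n).IsHomogeneous n := by
  simpa using (isHomogeneous_linForm w).pow n

theorem polyDeriv_linForm_pow (ξ : Euc d) (w : Fin d → ℂ) (n : ℕ) :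
    polyDeriv ξ (linForm w ^ (n + 1)) =
      (((n : ℂ) + 1) * MvPolynomial.eval (toComplex ξ) (linForm w)) • linForm w ^ n := by
  have h : ∀ j, MvPolynomial.pderiv j (linForm w) = MvPolynomial.C (w j) := by
    intro j
    simp [linForm, MvPolynomial.pderiv_X, Pi.single_apply]
  simp only [polyDeriv, Derivation.leibniz_pow, h, MvPolynomial.smul_eq_C_mul, smul_eq_mul,
    nsmul_eq_mul, Nat.add_sub_cancel]
  simp only [linForm, map_sum, map_mul, MvPolynomial.eval_C, MvPolynomial.eval_X, toComplex,
    Finset.mul_sum, Finset.sum_mul]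
  refine Finset.sum_congr rfl fun j _ => ?_
  simp
  ring

/-- At each real point `x` the Euler identity turns `W_{n+1}` into `T_x` with the direction frozen
at `x`. Intertwining replaces it by `∂_x`, and `∂_x ℓ^{n+1} = (n+1) ℓ(x) ℓⁿ`. -/
theorem IsIntertwining.opW_linForm_pow {R : Finset (Euc d)} {β : Euc d} {k : Euc d → ℂ}
    {V : CPoly d ≃ₗ[ℂ] CPoly d} (hV : IsIntertwining R β k V) (w : Fin d → ℂ) (n : ℕ) :
    opW R β k (n + 1) (V (linForm w ^ (n + 1))) =
      ((n : ℂ) + 1) • (linForm w * V (linForm w ^ n)) := by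
  refine polyFun_injective (funext fun x => ?_)
  rw [← dunklOperator_self R β k
    (hV.map_homogeneous (n + 1) _ (isHomogeneous_linForm_pow w (n + 1))) x, hV.intertwines,
    polyDeriv_linForm_pow, map_smul]
  simp [polyFun, mul_assoc]

theorem norm_eval_complexPoint_linForm_le {r : ℝ} {a b : Euc d} (ha : ‖a‖ ≤ r) (hb : ‖b‖ ≤ r)
    (z : Euc d) :
    ‖MvPolynomial.eval (complexPoint a b) (linForm (toComplex z))‖ ≤ 2 * r * ‖z‖ := by
  have h : MvPolynomial.eval (complexPoint a b) (linForm (toComplex z)) =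
      ((⟪z, a⟫_ℝ : ℝ) : ℂ) + Complex.I * ((⟪z, b⟫_ℝ : ℝ) : ℂ) := by
    simp only [linForm, map_sum, map_mul, MvPolynomial.eval_C, MvPolynomial.eval_X, complexPoint,
      toComplex, PiLp.inner_apply, Finset.mul_sum, Complex.ofReal_sum, ← Finset.sum_add_distrib]
    refine Finset.sum_congr rfl fun j _ => ?_
    simp [toComplex]
    ring
  rw [h]
  refine (norm_add_le _ _).trans ?_
  rw [norm_mul, Complex.norm_I, one_mul, Complex.norm_real, Complex.norm_real]
  have h1 := norm_inner_le_norm (𝕜 := ℝ) z a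
  have h2 := norm_inner_le_norm (𝕜 := ℝ) z b
  have h3 := mul_le_mul_of_nonneg_left ha (norm_nonneg z)
  have h4 := mul_le_mul_of_nonneg_left hb (norm_nonneg z)
  linarith

theorem isCompact_closedBall_prod (r : ℝ) :
    IsCompact (Metric.closedBall (0 : Euc d) r ×ˢ Metric.closedBall (0 : Euc d) r) :=
  (isCompact_closedBall _ _).prod (isCompact_closedBall _ _)

/-- The sum `|γ| + ∑_{α ∈ R₊} |k(α)|`. -/
def parameterBound (R : Finset (Euc d)) (β : Euc d) (k : Euc d → ℂ) : ℝ :=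
  ‖gammaParam R β k‖ + ∑ α ∈ posRoots R β, ‖k α‖

/-- In large degrees the operator `W_n` is bounded below on balls. -/
theorem norm_eval_le_of_opW {R : Finset (Euc d)} {β : Euc d} {k : Euc d → ℂ} {n : ℕ}
    (hn0 : 0 < n) (hn : 2 * parameterBound R β k ≤ n) {q : CPoly d} {r D : ℝ}
    (h : ∀ a b : Euc d, ‖a‖ ≤ r → ‖b‖ ≤ r →
      ‖MvPolynomial.eval (complexPoint a b) (opW R β k n q)‖ ≤ n * D)
    {a b : Euc d} (ha : ‖a‖ ≤ r) (hb : ‖b‖ ≤ r) :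
    ‖MvPolynomial.eval (complexPoint a b) q‖ ≤ 2 * D := by
  obtain ⟨⟨a₀, b₀⟩, hab₀, hmax⟩ := (isCompact_closedBall_prod r).exists_isMaxOn
    ⟨(a, b), by simp [ha, hb]⟩ (continuous_eval_complexPoint q).norm.continuousOn
  simp only [Set.mem_prod, mem_closedBall_zero_iff] at hab₀
  have hle : ∀ a b : Euc d, ‖a‖ ≤ r → ‖b‖ ≤ r →
      ‖MvPolynomial.eval (complexPoint a b) q‖ ≤ ‖MvPolynomial.eval (complexPoint a₀ b₀) q‖ :=
    fun a b ha hb => hmax (a := (a, b)) (by simp [ha, hb])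
  refine (hle a b ha hb).trans ?_
  set m := ‖MvPolynomial.eval (complexPoint a₀ b₀) q‖ with hm
  -- At a maximum point of `|q|`, solve the definition of `W_n` for `n q`. The reflected points stay
  -- in the balls, so all terms other than `W_n q` total at most `parameterBound` times the maximum
  -- `m`, hence at most `n m / 2`.
  have heq : (n : ℂ) * MvPolynomial.eval (complexPoint a₀ b₀) q =
      MvPolynomial.eval (complexPoint a₀ b₀) (opW R β k n q) -
        gammaParam R β k * MvPolynomial.eval (complexPoint a₀ b₀) q +
        ∑ α ∈ posRoots R β, k α * MvPolynomial.eval (complexPoint (sigma α a₀) (sigma α b₀)) q := by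
    simp only [opW, opA, map_sub, MvPolynomial.smul_eval, map_sum, eval_complexPoint_polyAction]
    ring
  have h1 : (n : ℝ) * m ≤ n * D + ‖gammaParam R β k‖ * m + (∑ α ∈ posRoots R β, ‖k α‖) * m := by
    calc (n : ℝ) * m = ‖(n : ℂ) * MvPolynomial.eval (complexPoint a₀ b₀) q‖ := by
          rw [norm_mul, Complex.norm_natCast]
      _ ≤ _ := by
          rw [heq]
          refine (norm_add_le _ _).trans (add_le_add ((norm_sub_le _ _).trans
            (add_le_add (h a₀ b₀ hab₀.1 hab₀.2) (norm_mul _ _).le)) ?_)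
          rw [Finset.sum_mul]
          refine (norm_sum_le _ _).trans (Finset.sum_le_sum fun α _ => ?_)
          rw [norm_mul]
          exact mul_le_mul_of_nonneg_left
            (hle _ _ (by simpa using hab₀.1) (by simpa using hab₀.2)) (norm_nonneg _)
  have hm0 : 0 ≤ m := norm_nonneg _
  have hnpos : (0 : ℝ) < n := by exact_mod_cast hn0
  have h2 := mul_le_mul_of_nonneg_right hn hm0
  rw [parameterBound] at h2
  have h3 : (n : ℝ) * m ≤ n * (2 * D) := by nlinarith
  exact le_of_mul_le_mul_left h3 hnpos

/-- Expansion of `V(⟨·, w⟩ⁿ)` in monomials in `w`. -/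
theorem map_linForm_pow (V : CPoly d →ₗ[ℂ] CPoly d) (w : Fin d → ℂ) (n : ℕ) :
    V (linForm w ^ n) =
      ∑ f : Fin n → Fin d, (∏ i, w (f i)) • V (∏ i, MvPolynomial.X (f i)) := by
  rw [linForm, Fintype.sum_pow, map_sum]
  refine Finset.sum_congr rfl fun f _ => ?_
  rw [Finset.prod_mul_distrib, ← map_prod, ← MvPolynomial.smul_eq_C_mul, map_smul]

/-- A crude bound whose constant depends on `n`. It serves the finitely many degrees in which `W_n`
has no explicit lower bound. -/
theorem exists_norm_eval_linForm_pow_le (V : CPoly d →ₗ[ℂ] CPoly d) (r : ℝ) (n : ℕ) :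
    ∃ B : ℝ, 0 ≤ B ∧ ∀ a b z : Euc d, ‖a‖ ≤ r → ‖b‖ ≤ r →
      ‖MvPolynomial.eval (complexPoint a b) (V (linForm (toComplex z) ^ n))‖ ≤ B * ‖z‖ ^ n := by
  have h : ∀ p : CPoly d, ∃ M : ℝ, 0 ≤ M ∧ ∀ a b : Euc d, ‖a‖ ≤ r → ‖b‖ ≤ r →
      ‖MvPolynomial.eval (complexPoint a b) p‖ ≤ M := by
    intro p
    obtain ⟨M, hM⟩ := (isCompact_closedBall_prod (d := d) r).exists_bound_of_continuousOn
      (continuous_eval_complexPoint p).continuousOn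
    refine ⟨max M 0, le_max_right _ _, fun a b ha hb => (hM (a, b) ?_).trans (le_max_left _ _)⟩
    simp [ha, hb]
  choose M hM0 hM using h
  refine ⟨∑ f : Fin n → Fin d, M (V (∏ i, MvPolynomial.X (f i))),
    Finset.sum_nonneg fun _ _ => hM0 _, fun a b z ha hb => ?_⟩
  rw [map_linForm_pow, map_sum, Finset.sum_mul]
  refine (norm_sum_le _ _).trans (Finset.sum_le_sum fun f _ => ?_)
  rw [MvPolynomial.smul_eval, norm_mul, mul_comm]
  refine mul_le_mul (hM _ a b ha hb) ?_ (norm_nonneg _) (hM0 _)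
  rw [norm_prod]
  calc ∏ i, ‖toComplex z (f i)‖ ≤ ∏ _i : Fin n, ‖z‖ :=
        Finset.prod_le_prod (fun _ _ => norm_nonneg _) fun i _ => norm_apply_le z (f i)
    _ = ‖z‖ ^ n := by simp

/-- Beyond degree `N` each step of the recursion costs a factor `2 · 2r‖z‖`: the `2` from inverting
`W_n`, the rest from the linear form. Degrees up to `N` are absorbed into `C`. -/
theorem IsIntertwining.exists_norm_eval_le {R : Finset (Euc d)} {β : Euc d} {k : Euc d → ℂ}
    {V : CPoly d ≃ₗ[ℂ] CPoly d} (hV : IsIntertwining R β k V) (x : Fin d → ℂ) :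
    ∃ C ρ : ℝ, ∀ (n : ℕ) (z : Euc d),
      ‖MvPolynomial.eval x (V (linForm (toComplex z) ^ n))‖ ≤ C * (ρ * ‖z‖) ^ n := by
  obtain ⟨a, b, rfl⟩ := exists_eq_complexPoint x
  set r := max ‖a‖ ‖b‖ with hr
  have hr0 : 0 ≤ r := (norm_nonneg a).trans (le_max_left _ _)
  choose B hB0 hB using fun n => exists_norm_eval_linForm_pow_le V.toLinearMap r n
  set N := ⌈2 * parameterBound R β k⌉₊
  set C := ∑ n ∈ Finset.range (N + 1), B n
  -- The added `1` makes the powers of the rate at least `1`, so that `C` alone controls the low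
  -- degrees.
  have hρ : 1 ≤ 4 * r + 1 := by linarith
  have hC0 : 0 ≤ C := Finset.sum_nonneg fun _ _ => hB0 _
  suffices h : ∀ (n : ℕ) (a b z : Euc d), ‖a‖ ≤ r → ‖b‖ ≤ r →
      ‖MvPolynomial.eval (complexPoint a b) (V (linForm (toComplex z) ^ n))‖ ≤
        C * ((4 * r + 1) * ‖z‖) ^ n from
    ⟨C, 4 * r + 1, fun n z => h n a b z (le_max_left _ _) (le_max_right _ _)⟩
  intro n
  induction n with
  | zero =>
    intro a b z ha hb
    refine (hB 0 a b z ha hb).trans ?_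
    simpa using Finset.single_le_sum (fun i _ => hB0 i) (Finset.mem_range.mpr N.succ_pos)
  | succ n ih =>
    intro a b z ha hb
    rcases le_or_gt (n + 1) N with hn | hn
    · refine (hB (n + 1) a b z ha hb).trans ?_
      rw [mul_pow, ← mul_assoc]
      gcongr
      have h1 : B (n + 1) ≤ C :=
        Finset.single_le_sum (fun i _ => hB0 i) (Finset.mem_range.mpr (by omega))
      exact h1.trans (le_mul_of_one_le_right hC0 (one_le_pow₀ hρ))
    · have hn' : 2 * parameterBound R β k ≤ ((n + 1 : ℕ) : ℝ) :=
        (Nat.le_ceil _).trans (by exact_mod_cast hn.le)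
      have hstep := norm_eval_le_of_opW (r := r) n.succ_pos hn'
        (q := V (linForm (toComplex z) ^ (n + 1)))
        (D := (2 * r * ‖z‖) * (C * ((4 * r + 1) * ‖z‖) ^ n)) (fun a b ha hb => by
          rw [hV.opW_linForm_pow, MvPolynomial.smul_eval, map_mul, norm_mul, norm_mul]
          have : ‖(n : ℂ) + 1‖ = ((n + 1 : ℕ) : ℝ) := by
            exact_mod_cast Complex.norm_natCast (n + 1)
          rw [this]
          gcongr
          · exact norm_eval_complexPoint_linForm_le ha hb z
          · exact ih a b z ha hb) ha hb
      refine hstep.trans ?_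
      rw [pow_succ]
      have : 0 ≤ C * ((4 * r + 1) * ‖z‖) ^ n * ‖z‖ := by positivity
      nlinarith

/-! ### Divided differences and Dunkl operators on polynomials -/

theorem polyFun_linForm (α x : Euc d) :
    polyFun (linForm (toComplex α)) x = ((⟪α, x⟫_ℝ : ℝ) : ℂ) := by
  simp [polyFun, linForm, toComplex, PiLp.inner_apply, mul_comm]

theorem linForm_ne_zero {α : Euc d} (hα : α ≠ 0) : linForm (toComplex α) ≠ 0 := by
  intro h
  have h1 := polyFun_linForm α α
  rw [h, real_inner_self_eq_norm_sq] at h1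
  have h2 : ((‖α‖ ^ 2 : ℝ) : ℂ) = 0 := by rw [← h1]; simp [polyFun]
  exact hα (by simpa using h2)

theorem polyAction_sigma_X (α : Euc d) (j : Fin d) :
    polyAction (sigma α) (MvPolynomial.X j) =
      MvPolynomial.X j - ((2 * α j / ‖α‖ ^ 2 : ℝ) : ℂ) • linForm (toComplex α) := by
  refine polyFun_injective (funext fun x => ?_)
  rw [polyFun_polyAction]
  have h := polyFun_linForm α x
  simp only [polyFun] at h
  simp only [polyFun, map_sub, MvPolynomial.smul_eval, MvPolynomial.eval_X, h, toComplex,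
    sigma_apply, PiLp.sub_apply, PiLp.smul_apply, smul_eq_mul, real_inner_comm x α]
  push_cast
  ring

/-- With `σ` the substitution, `pX_j - σ(p)σ(X_j) = (p - σp)X_j + σ(p)(X_j - σX_j)`, and `X_j -
σX_j` is a multiple of the linear form. -/
theorem exists_linForm_mul_eq (α : Euc d) (p : CPoly d) :
    ∃ q, linForm (toComplex α) * q = p - polyAction (sigma α) p := by
  induction p using MvPolynomial.induction_on with
  | C a => exact ⟨0, by simp [polyAction]⟩
  | add p q hp hq =>
    obtain ⟨p', hp⟩ := hp
    obtain ⟨q', hq⟩ := hq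
    exact ⟨p' + q', by rw [mul_add, hp, hq, map_add]; ring⟩
  | mul_X p j hp =>
    obtain ⟨q, hq⟩ := hp
    refine ⟨q * MvPolynomial.X j +
      ((2 * α j / ‖α‖ ^ 2 : ℝ) : ℂ) • polyAction (sigma α) p, ?_⟩
    rw [map_mul, polyAction_sigma_X, mul_add, ← mul_assoc, hq]
    simp only [MvPolynomial.smul_eq_C_mul]
    ring

open Classical in
/-- The divided difference `p ↦ (p - p ∘ σ_α) / ⟪α, ·⟫` on polynomials. -/
def dividedDifference (α : Euc d) : CPoly d →ₗ[ℂ] CPoly d :=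
  -- For `α = 0` the quotient is not unique and the chosen one need not be linear. Otherwise
  -- cancelling the linear form gives linearity.
  if hα : α = 0 then 0 else
    { toFun := fun p => (exists_linForm_mul_eq α p).choose
      map_add' := fun p q => by
        refine mul_left_cancel₀ (linForm_ne_zero hα) ?_
        rw [mul_add, (exists_linForm_mul_eq α _).choose_spec,
          (exists_linForm_mul_eq α _).choose_spec, (exists_linForm_mul_eq α _).choose_spec, map_add]
        ring
      map_smul' := fun c p => by
        refine mul_left_cancel₀ (linForm_ne_zero hα) ?_
        rw [RingHom.id_apply, mul_smul_comm, (exists_linForm_mul_eq α _).choose_spec,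
          (exists_linForm_mul_eq α _).choose_spec, map_smul, smul_sub] }

theorem linForm_mul_dividedDifference {α : Euc d} (hα : α ≠ 0) (p : CPoly d) :
    linForm (toComplex α) * dividedDifference α p = p - polyAction (sigma α) p := by
  rw [dividedDifference, dif_neg hα]
  exact (exists_linForm_mul_eq α p).choose_spec

theorem dividedDifference_eq {α : Euc d} (hα : α ≠ 0) {p q : CPoly d}
    (h : linForm (toComplex α) * q = p - polyAction (sigma α) p) : dividedDifference α p = q :=
  mul_left_cancel₀ (linForm_ne_zero hα) ((linForm_mul_dividedDifference hα p).trans h.symm)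

theorem dividedDifference_C {α : Euc d} (hα : α ≠ 0) (a : ℂ) :
    dividedDifference α (MvPolynomial.C a) = 0 :=
  dividedDifference_eq hα (by simp [polyAction])

theorem dividedDifference_mul_X {α : Euc d} (hα : α ≠ 0) (p : CPoly d) (j : Fin d) :
    dividedDifference α (p * MvPolynomial.X j) = dividedDifference α p * MvPolynomial.X j +
      ((2 * α j / ‖α‖ ^ 2 : ℝ) : ℂ) • polyAction (sigma α) p := by
  refine dividedDifference_eq hα ?_
  rw [map_mul, polyAction_sigma_X, mul_add, ← mul_assoc, linForm_mul_dividedDifference hα]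
  simp only [MvPolynomial.smul_eq_C_mul]
  ring

theorem sigma_neg (α : Euc d) : sigma (-α) = sigma α := by
  ext1 x
  simp [sigma_apply, neg_div]

theorem sigma_self (α : Euc d) : sigma α α = -α := by
  rcases eq_or_ne α 0 with rfl | hα
  · simp
  · have : ‖α‖ ^ 2 ≠ 0 := by simpa using hα
    rw [sigma_apply, real_inner_self_eq_norm_sq, mul_div_assoc, div_self this, mul_one, two_smul]
    abel

theorem sigma_sigma (α x : Euc d) : sigma α (sigma α x) = x :=
  Submodule.reflection_reflection _ x

theorem sigma_map (g : Euc d ≃ₗᵢ[ℝ] Euc d) (α x : Euc d) :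
    sigma (g α) (g x) = g (sigma α x) := by
  simp [sigma_apply]

theorem dividedDifference_neg {α : Euc d} (hα : α ≠ 0) (p : CPoly d) :
    dividedDifference (-α) p = -dividedDifference α p := by
  refine dividedDifference_eq (neg_ne_zero.mpr hα) ?_
  have h : linForm (toComplex (-α)) = -linForm (toComplex α) := by
    simp [linForm, toComplex]
  rw [sigma_neg, h, neg_mul_neg, linForm_mul_dividedDifference hα]

theorem polyAction_linForm (g : Euc d ≃ₗᵢ[ℝ] Euc d) (α : Euc d) :
    polyAction g (linForm (toComplex (g α))) = linForm (toComplex α) := by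
  refine polyFun_injective (funext fun x => ?_)
  rw [polyFun_polyAction, polyFun_linForm, polyFun_linForm, LinearIsometryEquiv.inner_map_map]

theorem polyAction_dividedDifference (g : Euc d ≃ₗᵢ[ℝ] Euc d) {α : Euc d} (hα : α ≠ 0)
    (p : CPoly d) :
    polyAction g (dividedDifference (g α) p) = dividedDifference α (polyAction g p) := by
  have hg : g α ≠ 0 := by simpa using hα
  have hσ : polyAction g (polyAction (sigma (g α)) p) = polyAction (sigma α) (polyAction g p) := by
    refine polyFun_injective (funext fun x => ?_)
    rw [polyFun_polyAction, polyFun_polyAction, polyFun_polyAction, polyFun_polyAction, sigma_map]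
  have h : linForm (toComplex α) * polyAction g (dividedDifference (g α) p) =
      polyAction g p - polyAction (sigma α) (polyAction g p) := by
    rw [← polyAction_linForm g α, ← map_mul, linForm_mul_dividedDifference hg, map_sub, hσ]
  exact (dividedDifference_eq hα h).symm

theorem polyDeriv_polyAction (g : Euc d ≃ₗᵢ[ℝ] Euc d) (ξ : Euc d) (p : CPoly d) :
    polyAction g (polyDeriv (g ξ) p) = polyDeriv ξ (polyAction g p) := by
  refine polyFun_injective (funext fun x => ?_)
  have h : polyFun (polyAction g p) = polyFun p ∘ g := funext fun x => polyFun_polyAction g p x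
  rw [polyFun_polyAction, ← fderiv_polyFun, ← fderiv_polyFun, h,
    fderiv_comp x (differentiable_polyFun p _) g.differentiableAt]
  have hg : fderiv ℝ g x = (g : Euc d →L[ℝ] Euc d) :=
    (g.toContinuousLinearEquiv : Euc d →L[ℝ] Euc d).fderiv
  rw [hg]
  rfl

/-- On the hyperplane, differentiate `⟨α, ·⟩ q = p - p ∘ σ_α` along `α`. The left side gives `‖α‖²
q(x)`, and the right side `2 ∂_α p(x)` because `σ_α α = -α`. -/
theorem polyFun_dividedDifference {α : Euc d} (hα : α ≠ 0) (p : CPoly d) (x : Euc d) :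
    polyFun (dividedDifference α p) x = reflectionQuotient α (polyFun p) x := by
  have hs := linForm_mul_dividedDifference hα p
  have hα2 : ((‖α‖ ^ 2 : ℝ) : ℂ) ≠ 0 := by simpa using hα
  rw [reflectionQuotient]
  split_ifs with hx
  · have hσ : sigma α x = x := by
      rw [sigma_apply, real_inner_comm, hx]
      simp
    have h1 := congrArg (fun q => fderiv ℝ (polyFun q) x α) hs
    have hmul : polyFun (linForm (toComplex α) * dividedDifference α p) =
        fun z => polyFun (linForm (toComplex α)) z * polyFun (dividedDifference α p) z := by
      funext z
      simp [polyFun]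
    have hsub : polyFun (p - polyAction (sigma α) p) =
        fun z => polyFun p z - polyFun (polyAction (sigma α) p) z := by
      funext z
      simp [polyFun]
    have hl : fderiv ℝ (polyFun (linForm (toComplex α))) x α = ((‖α‖ ^ 2 : ℝ) : ℂ) := by
      have := polyDeriv_linForm_pow α (toComplex α) 0
      have h2 := polyFun_linForm α α
      rw [polyFun] at h2
      rw [zero_add, pow_one, pow_zero, h2, real_inner_self_eq_norm_sq] at this
      rw [fderiv_polyFun, this]
      simp [polyFun]
    have hneg : fderiv ℝ (polyFun (polyAction (sigma α) p)) x α = -fderiv ℝ (polyFun p) x α := by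
      rw [fderiv_polyFun, ← polyDeriv_polyAction, polyFun_polyAction, hσ, sigma_self,
        ← fderiv_polyFun, map_neg]
    simp only [hmul, hsub] at h1
    rw [fderiv_fun_mul (differentiable_polyFun _ x) (differentiable_polyFun _ x),
      fderiv_fun_sub (differentiable_polyFun _ x) (differentiable_polyFun _ x)] at h1
    simp only [_root_.add_apply, _root_.smul_apply,
      _root_.sub_apply, hl, hneg, polyFun_linForm, hx, smul_eq_mul] at h1
    have h3 : ((2 / ‖α‖ ^ 2 : ℝ) : ℂ) = 2 / ((‖α‖ ^ 2 : ℝ) : ℂ) := by push_cast; rfl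
    rw [h3]
    field_simp
    simp only [Complex.ofReal_zero, zero_mul, zero_add] at h1
    linear_combination h1
  · have hx' : ((⟪α, x⟫_ℝ : ℝ) : ℂ) ≠ 0 := by exact_mod_cast hx
    rw [eq_div_iff hx', mul_comm, ← polyFun_linForm, ← polyFun_polyAction]
    simpa [polyFun] using congrArg (fun q => polyFun q x) hs

/-- The directional derivative as a linear map. -/
def polyDerivLinear (ξ : Euc d) : CPoly d →ₗ[ℂ] CPoly d :=
  ∑ j, (ξ j : ℂ) • (MvPolynomial.pderiv j).toLinearMap

theorem polyDerivLinear_apply (ξ : Euc d) (p : CPoly d) : polyDerivLinear ξ p = polyDeriv ξ p := by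
  simp only [polyDerivLinear, polyDeriv, LinearMap.sum_apply, LinearMap.smul_apply,
    ← MvPolynomial.smul_eq_C_mul]
  rfl

/-- The Dunkl operator on polynomials. -/
def dunklPoly (R : Finset (Euc d)) (β : Euc d) (k : Euc d → ℂ) (ξ : Euc d) :
    CPoly d →ₗ[ℂ] CPoly d :=
  polyDerivLinear ξ + ∑ α ∈ posRoots R β, (k α * ((⟪α, ξ⟫_ℝ : ℝ) : ℂ)) • dividedDifference α

theorem dunklPoly_apply (R : Finset (Euc d)) (β : Euc d) (k : Euc d → ℂ) (ξ : Euc d)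
    (p : CPoly d) :
    dunklPoly R β k ξ p = polyDeriv ξ p +
      ∑ α ∈ posRoots R β, (k α * ((⟪α, ξ⟫_ℝ : ℝ) : ℂ)) • dividedDifference α p := by
  simp [dunklPoly, polyDerivLinear_apply]

theorem ne_zero_of_mem_posRoots {R : Finset (Euc d)} {β α : Euc d} (hα : α ∈ posRoots R β) :
    α ≠ 0 := by
  rintro rfl
  simpa using (Finset.mem_filter.mp hα).2

theorem polyFun_dunklPoly (R : Finset (Euc d)) (β : Euc d) (k : Euc d → ℂ) (ξ : Euc d)
    (p : CPoly d) (x : Euc d) :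
    polyFun (dunklPoly R β k ξ p) x = dunklOperator R β k ξ (polyFun p) x := by
  have h : ∀ α ∈ posRoots R β, k α * ((⟪α, ξ⟫_ℝ : ℝ) : ℂ) * reflectionQuotient α (polyFun p) x =
      k α * ((⟪α, ξ⟫_ℝ : ℝ) : ℂ) * polyFun (dividedDifference α p) x := fun α hα => by
    rw [polyFun_dividedDifference (ne_zero_of_mem_posRoots hα)]
  rw [dunklOperator, fderiv_polyFun, Finset.sum_congr rfl h, dunklPoly_apply]
  simp [polyFun]

theorem dunklPoly_C (R : Finset (Euc d)) (β : Euc d) (k : Euc d → ℂ) (ξ : Euc d) (a : ℂ) :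
    dunklPoly R β k ξ (MvPolynomial.C a) = 0 := by
  have h : ∑ α ∈ posRoots R β, (k α * ((⟪α, ξ⟫_ℝ : ℝ) : ℂ)) •
      dividedDifference α (MvPolynomial.C a : CPoly d) = 0 :=
    Finset.sum_eq_zero fun α hα => by
      rw [dividedDifference_C (ne_zero_of_mem_posRoots hα), smul_zero]
  rw [dunklPoly_apply, h]
  simp [polyDeriv]

theorem dunklPoly_mul_X (R : Finset (Euc d)) (β : Euc d) (k : Euc d → ℂ) (ξ : Euc d)
    (p : CPoly d) (j : Fin d) :
    dunklPoly R β k ξ (p * MvPolynomial.X j) =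
      dunklPoly R β k ξ p * MvPolynomial.X j + (ξ j : ℂ) • p +
        ∑ α ∈ posRoots R β, (k α * ((⟪α, ξ⟫_ℝ : ℝ) : ℂ) * ((2 * α j / ‖α‖ ^ 2 : ℝ) : ℂ)) •
          polyAction (sigma α) p := by
  have h1 : polyDeriv ξ (p * MvPolynomial.X j) =
      polyDeriv ξ p * MvPolynomial.X j + (ξ j : ℂ) • p := by
    simp only [polyDeriv, Derivation.leibniz, MvPolynomial.pderiv_X, smul_eq_mul, mul_add,
      Finset.sum_add_distrib, Finset.sum_mul]
    rw [add_comm]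
    congr 1
    · exact Finset.sum_congr rfl fun i _ => by ring
    · simp [Pi.single_apply, MvPolynomial.smul_eq_C_mul]
  rw [dunklPoly_apply, dunklPoly_apply, h1, Finset.sum_congr rfl fun α hα => by
    rw [dividedDifference_mul_X (ne_zero_of_mem_posRoots hα), smul_add, smul_smul],
    Finset.sum_add_distrib, add_mul, Finset.sum_mul]
  simp only [smul_mul_assoc]
  abel

theorem dunklPoly_add_smul (R : Finset (Euc d)) (β : Euc d) (k : Euc d → ℂ) (ξ η : Euc d)
    (c : ℝ) (p : CPoly d) :
    dunklPoly R β k (ξ + c • η) p = dunklPoly R β k ξ p + (c : ℂ) • dunklPoly R β k η p := by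
  simp only [dunklPoly_apply, polyDeriv, smul_add, Finset.smul_sum, smul_smul, inner_add_right,
    inner_smul_right, PiLp.add_apply, PiLp.smul_apply, smul_eq_mul, Complex.ofReal_add,
    Complex.ofReal_mul, map_add, map_mul, add_mul, mul_add, add_smul, Finset.sum_add_distrib]
  rw [add_add_add_comm]
  congr 2
  · exact Finset.sum_congr rfl fun j _ => by rw [MvPolynomial.smul_eq_C_mul]; ring
  · exact Finset.sum_congr rfl fun α _ => by congr 1; ring

/-! ### Equivariance and commutativity -/

theorem IsRootSystem.neg_mem {R : Finset (Euc d)} (hR : IsRootSystem R) {α : Euc d}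
    (hα : α ∈ R) : -α ∈ R := sigma_self α ▸ hR.sigma_mem α hα α hα

theorem IsParameterFunction.sigma {R : Finset (Euc d)} {k : Euc d → ℂ}
    (hk : IsParameterFunction R k) {α γ : Euc d} (hγ : γ ∈ R) (hα : α ∈ R) :
    k (DunklTheory.sigma γ α) = k α :=
  hk _ (Subgroup.subset_closure ⟨γ, hγ, rfl⟩) α hα

/-- Sums of even functions over a root system are twice the sums over the positive roots. -/
theorem sum_root_eq_two_nsmul {M : Type*} [AddCommGroup M] {R : Finset (Euc d)}
    (hR : IsRootSystem R) {β : Euc d} (hβ : ∀ α ∈ R, ⟪α, β⟫_ℝ ≠ 0) {F : Euc d → M}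
    (hF : ∀ α ∈ R, F (-α) = F α) :
    ∑ α ∈ R, F α = 2 • ∑ α ∈ posRoots R β, F α := by
  classical
  rw [two_nsmul, ← Finset.sum_filter_add_sum_filter_not R (fun α => 0 < ⟪α, β⟫_ℝ)]
  have e : posRoots R β = R.filter fun α => 0 < ⟪α, β⟫_ℝ := by
    ext α
    simp [posRoots]
  rw [e]
  congr 1
  refine Finset.sum_nbij' (fun α => -α) (fun α => -α) ?_ ?_ (by simp) (by simp) ?_
  · intro α hα
    rw [Finset.mem_filter] at hα ⊢
    refine ⟨hR.neg_mem hα.1, ?_⟩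
    rw [inner_neg_left]
    have := lt_of_le_of_ne (not_lt.mp hα.2) (hβ α hα.1)
    linarith
  · intro α hα
    rw [Finset.mem_filter] at hα ⊢
    refine ⟨hR.neg_mem hα.1, ?_⟩
    rw [inner_neg_left]
    linarith [hα.2]
  · intro α hα
    exact (hF α (Finset.mem_filter.mp hα).1).symm

/-- The reflection permutes `R` but not `R₊`. For even summands the sum over `R₊` is half the sum
over `R`, which is invariant. -/
theorem sum_posRoots_sigma {R : Finset (Euc d)} (hR : IsRootSystem R) {β : Euc d}
    (hβ : ∀ α ∈ R, ⟪α, β⟫_ℝ ≠ 0) {F : Euc d → CPoly d} (hF : ∀ α ∈ R, F (-α) = F α)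
    {γ : Euc d} (hγ : γ ∈ R) :
    ∑ α ∈ posRoots R β, F (sigma γ α) = ∑ α ∈ posRoots R β, F α := by
  have h1 := sum_root_eq_two_nsmul hR hβ hF
  have h2 := sum_root_eq_two_nsmul hR hβ (F := fun α => F (sigma γ α))
    (fun α hα => by rw [map_neg]; exact hF _ (hR.sigma_mem γ hγ α hα))
  have h3 : ∑ α ∈ R, F (sigma γ α) = ∑ α ∈ R, F α :=
    Finset.sum_nbij' (sigma γ) (sigma γ) (fun α hα => hR.sigma_mem γ hγ α hα)
      (fun α hα => hR.sigma_mem γ hγ α hα) (fun α _ => sigma_sigma γ α)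
      (fun α _ => sigma_sigma γ α) (fun α _ => rfl)
  rw [h1, h2] at h3
  exact smul_right_injective (CPoly d) two_ne_zero h3

theorem polyAction_sigma_dunklPoly {R : Finset (Euc d)} (hR : IsRootSystem R) {β : Euc d}
    (hβ : ∀ α ∈ R, ⟪α, β⟫_ℝ ≠ 0) {k : Euc d → ℂ} (hk : IsParameterFunction R k) {γ : Euc d}
    (hγ : γ ∈ R) (ξ : Euc d) (p : CPoly d) :
    polyAction (sigma γ) (dunklPoly R β k ξ p) =
      dunklPoly R β k (sigma γ ξ) (polyAction (sigma γ) p) := by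
  rw [dunklPoly_apply, dunklPoly_apply, map_add, map_sum, ← polyDeriv_polyAction, sigma_sigma]
  congr 1
  have hne : ∀ α ∈ R, α ≠ 0 := fun α hα h => hR.zero_notMem (h ▸ hα)
  rw [← sum_posRoots_sigma hR hβ (γ := γ) (F := fun α =>
    (k α * ((⟪α, sigma γ ξ⟫_ℝ : ℝ) : ℂ)) • dividedDifference α (polyAction (sigma γ) p)) ?_ hγ]
  · refine Finset.sum_congr rfl fun α hα => ?_
    have hα' : α ∈ R := (Finset.mem_filter.mp hα).1
    rw [map_smul, hk.sigma hγ hα', LinearIsometryEquiv.inner_map_map,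
      ← polyAction_dividedDifference _ (hne _ (hR.sigma_mem γ hγ α hα')), sigma_sigma]
  -- The summand is even: the inner product and the divided difference both change sign, and `k(-α)
  -- = k(σ_α α) = k(α)`.
  · intro α hα
    rw [dividedDifference_neg (hne α hα), ← sigma_self, hk.sigma hα hα, sigma_self,
      inner_neg_left]
    simp

/-- The Dunkl operators commute. -/
theorem dunklPoly_comm {R : Finset (Euc d)} (hR : IsRootSystem R) {β : Euc d}
    (hβ : ∀ α ∈ R, ⟪α, β⟫_ℝ ≠ 0) {k : Euc d → ℂ} (hk : IsParameterFunction R k) (ξ η : Euc d)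
    (p : CPoly d) :
    dunklPoly R β k ξ (dunklPoly R β k η p) = dunklPoly R β k η (dunklPoly R β k ξ p) := by
  induction p using MvPolynomial.induction_on with
  | C a => simp only [dunklPoly_C, map_zero]
  | add p q hp hq => simp only [map_add, hp, hq]
  | mul_X p j hp =>
    have hcomm : ∀ α ∈ posRoots R β, ∀ ζ : Euc d,
        polyAction (sigma α) (dunklPoly R β k ζ p) =
          dunklPoly R β k ζ (polyAction (sigma α) p) +
            ((-(2 * ⟪ζ, α⟫_ℝ / ‖α‖ ^ 2) : ℝ) : ℂ) •
              dunklPoly R β k α (polyAction (sigma α) p) := by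
      intro α hα ζ
      rw [polyAction_sigma_dunklPoly hR hβ hk (Finset.mem_filter.mp hα).1, sigma_apply,
        sub_eq_add_neg, ← neg_smul, dunklPoly_add_smul]
    simp only [dunklPoly_mul_X, map_add, map_sum, map_smul, hp]
    have hsum : ∀ ζ ω : Euc d, ∑ α ∈ posRoots R β, (k α * ((⟪α, ζ⟫_ℝ : ℝ) : ℂ) *
        ((2 * α j / ‖α‖ ^ 2 : ℝ) : ℂ)) • polyAction (sigma α) (dunklPoly R β k ω p) =
        ∑ α ∈ posRoots R β, (k α * ((⟪α, ζ⟫_ℝ : ℝ) : ℂ) * ((2 * α j / ‖α‖ ^ 2 : ℝ) : ℂ)) •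
          dunklPoly R β k ω (polyAction (sigma α) p) +
        ∑ α ∈ posRoots R β, (k α * ((⟪α, ζ⟫_ℝ : ℝ) : ℂ) * ((2 * α j / ‖α‖ ^ 2 : ℝ) : ℂ) *
          ((-(2 * ⟪ω, α⟫_ℝ / ‖α‖ ^ 2) : ℝ) : ℂ)) •
            dunklPoly R β k α (polyAction (sigma α) p) := by
      intro ζ ω
      rw [← Finset.sum_add_distrib]
      exact Finset.sum_congr rfl fun α hα => by rw [hcomm α hα ω, smul_add, smul_smul]
    rw [hsum ξ η, hsum η ξ]
    -- Moving the reflections past the Dunkl operators leaves correction terms containing `⟨α, ξ⟩⟨α,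
    -- η⟩`, symmetric in `ξ` and `η`. They cancel in the commutator.
    have hsymm : ∑ α ∈ posRoots R β, (k α * ((⟪α, ξ⟫_ℝ : ℝ) : ℂ) *
        ((2 * α j / ‖α‖ ^ 2 : ℝ) : ℂ) * ((-(2 * ⟪η, α⟫_ℝ / ‖α‖ ^ 2) : ℝ) : ℂ)) •
          dunklPoly R β k α (polyAction (sigma α) p) =
        ∑ α ∈ posRoots R β, (k α * ((⟪α, η⟫_ℝ : ℝ) : ℂ) *
        ((2 * α j / ‖α‖ ^ 2 : ℝ) : ℂ) * ((-(2 * ⟪ξ, α⟫_ℝ / ‖α‖ ^ 2) : ℝ) : ℂ)) •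
          dunklPoly R β k α (polyAction (sigma α) p) := by
      refine Finset.sum_congr rfl fun α _ => ?_
      congr 1
      rw [real_inner_comm α η, real_inner_comm α ξ]
      push_cast
      ring
    rw [hsymm]
    abel

/-! ### Existence of the intertwining operator -/

theorem IsHomogeneous.homogeneousComponent_mul {l : CPoly d} (hl : l.IsHomogeneous 1) (q : CPoly d)
    (n : ℕ) :
    MvPolynomial.homogeneousComponent (n + 1) (l * q) =
      l * MvPolynomial.homogeneousComponent n q := by
  conv_lhs => rw [← MvPolynomial.sum_homogeneousComponent q, Finset.mul_sum, map_sum]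
  have h : ∀ i, MvPolynomial.homogeneousComponent (n + 1)
      (l * MvPolynomial.homogeneousComponent i q) =
      if n = i then l * MvPolynomial.homogeneousComponent i q else 0 := by
    intro i
    have hi : (l * MvPolynomial.homogeneousComponent i q).IsHomogeneous (i + 1) := by
      rw [add_comm]
      exact hl.mul (MvPolynomial.homogeneousComponent_isHomogeneous i q)
    rw [MvPolynomial.homogeneousComponent_of_mem hi]
    simp
  simp only [h, Finset.sum_ite_eq, Finset.mem_range]
  split_ifs with hn
  · rfl
  · rw [MvPolynomial.homogeneousComponent_eq_zero _ _ (by omega), mul_zero]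

theorem IsHomogeneous.polyAction {p : CPoly d} {n : ℕ} (hp : p.IsHomogeneous n)
    (g : Euc d ≃ₗᵢ[ℝ] Euc d) : (polyAction g p).IsHomogeneous n := by
  have h := hp.aeval (fun i => ∑ j,
    MvPolynomial.C ((g (EuclideanSpace.single j 1) i : ℝ) : ℂ) * MvPolynomial.X j) (n := 1)
    fun i => isHomogeneous_linForm fun j => ((g (EuclideanSpace.single j 1) i : ℝ) : ℂ)
  rw [one_mul] at h
  exact h

/-- If `ℓq` is homogeneous of degree `n + 1`, it equals `ℓ` times the degree `n` component of `q`.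
Cancel `ℓ`. -/
theorem IsHomogeneous.dividedDifference {p : CPoly d} {n : ℕ} (hp : p.IsHomogeneous (n + 1))
    {α : Euc d} (hα : α ≠ 0) : (dividedDifference α p).IsHomogeneous n := by
  have h : (p - DunklTheory.polyAction (sigma α) p).IsHomogeneous (n + 1) :=
    hp.sub (IsHomogeneous.polyAction hp _)
  rw [← linForm_mul_dividedDifference hα] at h
  have h2 := IsHomogeneous.homogeneousComponent_mul (isHomogeneous_linForm (toComplex α))
    (DunklTheory.dividedDifference α p) n
  rw [MvPolynomial.homogeneousComponent_eq_self h] at h2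
  rw [mul_left_cancel₀ (linForm_ne_zero hα) h2]
  exact MvPolynomial.homogeneousComponent_isHomogeneous _ _

theorem IsHomogeneous.dunklPoly {p : CPoly d} {n : ℕ} (hp : p.IsHomogeneous (n + 1))
    (R : Finset (Euc d)) (β : Euc d) (k : Euc d → ℂ) (ξ : Euc d) :
    (dunklPoly R β k ξ p).IsHomogeneous n := by
  rw [dunklPoly_apply]
  refine (MvPolynomial.homogeneousSubmodule (Fin d) ℂ n).add_mem
    (Submodule.sum_mem _ fun j _ => ?_)
    (Submodule.sum_mem _ fun α hα => Submodule.smul_mem _ _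
      (IsHomogeneous.dividedDifference hp (ne_zero_of_mem_posRoots hα)))
  rw [← MvPolynomial.smul_eq_C_mul]
  exact Submodule.smul_mem _ _ hp.pderiv

/-- The homogeneous parts of the inverse of the intertwining operator. -/
def dualIntertwiningPart (R : Finset (Euc d)) (β : Euc d) (k : Euc d → ℂ) :
    ℕ → CPoly d →ₗ[ℂ] CPoly d
  | 0 => MvPolynomial.homogeneousComponent 0
  | n + 1 => ((n : ℂ) + 1)⁻¹ • ∑ j, LinearMap.mulLeft ℂ (MvPolynomial.X j) ∘ₗ
      dualIntertwiningPart R β k n ∘ₗ dunklPoly R β k (EuclideanSpace.single j 1)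

theorem dualIntertwiningPart_succ (R : Finset (Euc d)) (β : Euc d) (k : Euc d → ℂ) (n : ℕ)
    (p : CPoly d) :
    dualIntertwiningPart R β k (n + 1) p = ((n : ℂ) + 1)⁻¹ • ∑ j, MvPolynomial.X j *
      dualIntertwiningPart R β k n (dunklPoly R β k (EuclideanSpace.single j 1) p) := by
  simp [dualIntertwiningPart]

theorem isHomogeneous_dualIntertwiningPart (R : Finset (Euc d)) (β : Euc d) (k : Euc d → ℂ)
    (n : ℕ) (p : CPoly d) : (dualIntertwiningPart R β k n p).IsHomogeneous n := by
  induction n generalizing p with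
  | zero => exact MvPolynomial.homogeneousComponent_isHomogeneous _ _
  | succ n ih =>
    rw [dualIntertwiningPart_succ]
    refine (MvPolynomial.homogeneousSubmodule (Fin d) ℂ (n + 1)).smul_mem _
      (Submodule.sum_mem _ fun j _ => ?_)
    rw [MvPolynomial.mem_homogeneousSubmodule, add_comm]
    exact (MvPolynomial.isHomogeneous_X ℂ j).mul (ih _)

/-- Write `S_n` for the parts. In the inductive step the product rule gives `S_{n+1} T_i p + ∑ x_j
S_n T_i T_j p`. Commuting `T_i` with `T_j` turns the sum into `(n+1) S_{n+1} T_i p`, and the total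
factor `n + 2` cancels the normalisation. Commutativity of the Dunkl operators is used only here. -/
theorem pderiv_dualIntertwiningPart {R : Finset (Euc d)} (hR : IsRootSystem R) {β : Euc d}
    (hβ : ∀ α ∈ R, ⟪α, β⟫_ℝ ≠ 0) {k : Euc d → ℂ} (hk : IsParameterFunction R k) (n : ℕ)
    (i : Fin d) (p : CPoly d) :
    MvPolynomial.pderiv i (dualIntertwiningPart R β k (n + 1) p) =
      dualIntertwiningPart R β k n (dunklPoly R β k (EuclideanSpace.single i 1) p) := by
  induction n generalizing p with
  | zero =>
    rw [dualIntertwiningPart_succ]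
    simp [dualIntertwiningPart, MvPolynomial.homogeneousComponent_zero, MvPolynomial.pderiv_X,
      Pi.single_apply]
  | succ n ih =>
    rw [dualIntertwiningPart_succ, (MvPolynomial.pderiv i).map_smul, map_sum]
    simp only [Derivation.leibniz, ih, smul_eq_mul, MvPolynomial.pderiv_X, Finset.sum_add_distrib]
    simp only [dunklPoly_comm hR hβ hk (EuclideanSpace.single i 1)]
    have h := dualIntertwiningPart_succ R β k n (dunklPoly R β k (EuclideanSpace.single i 1) p)
    have hn : ((n : ℂ) + 1) ≠ 0 := by exact_mod_cast n.succ_ne_zero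
    have hn' : (((n + 1 : ℕ) : ℂ) + 1) ≠ 0 := by exact_mod_cast (n + 1).succ_ne_zero
    rw [eq_inv_smul_iff₀ hn] at h
    rw [← h, inv_smul_eq_iff₀ hn']
    simp only [Pi.single_apply, mul_ite, mul_one, mul_zero, Finset.mem_univ,
      if_true, Finset.sum_ite_eq']
    push_cast
    simp only [add_smul, one_smul]

theorem dunklPoly_eq_sum (R : Finset (Euc d)) (β : Euc d) (k : Euc d → ℂ) (ξ : Euc d)
    (p : CPoly d) :
    dunklPoly R β k ξ p =
      ∑ j, (ξ j : ℂ) • dunklPoly R β k (EuclideanSpace.single j 1) p := by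
  have h0 : dunklPoly R β k 0 p = 0 := by
    rw [dunklPoly_apply]
    simp [polyDeriv]
  have h : ∀ s : Finset (Fin d),
      dunklPoly R β k (∑ j ∈ s, ξ j • EuclideanSpace.single j (1 : ℝ)) p =
        ∑ j ∈ s, (ξ j : ℂ) • dunklPoly R β k (EuclideanSpace.single j 1) p := by
    classical
    intro s
    induction s using Finset.induction_on with
    | empty => simpa using h0
    | insert a s ha ih =>
      rw [Finset.sum_insert ha, Finset.sum_insert ha, add_comm, dunklPoly_add_smul, ih, add_comm]
  rw [← h]
  congr 2
  ext i
  simp [Pi.single_apply]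

/-- The inverse of the intertwining operator. -/
def dualIntertwining (R : Finset (Euc d)) (β : Euc d) (k : Euc d → ℂ) : CPoly d →ₗ[ℂ] CPoly d :=
  (MvPolynomial.basisMonomials (Fin d) ℂ).constr ℂ fun m =>
    dualIntertwiningPart R β k m.degree (MvPolynomial.monomial m 1)

theorem dualIntertwining_of_isHomogeneous (R : Finset (Euc d)) (β : Euc d) (k : Euc d → ℂ)
    {n : ℕ} {p : CPoly d} (hp : p.IsHomogeneous n) :
    dualIntertwining R β k p = dualIntertwiningPart R β k n p := by
  rw [MvPolynomial.as_sum p, map_sum, map_sum]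
  refine Finset.sum_congr rfl fun m hm => ?_
  have hdeg : m.degree = n := by
    rw [Finsupp.degree_eq_weight_one]
    exact hp (MvPolynomial.mem_support_iff.mp hm)
  have h1 : MvPolynomial.monomial m (MvPolynomial.coeff m p) =
      MvPolynomial.coeff m p • MvPolynomial.basisMonomials (Fin d) ℂ m := by
    simp [MvPolynomial.smul_monomial]
  rw [h1, map_smul, map_smul, dualIntertwining, Module.Basis.constr_basis, hdeg]
  simp

theorem isHomogeneous_dualIntertwining (R : Finset (Euc d)) (β : Euc d) (k : Euc d → ℂ)
    {n : ℕ} {p : CPoly d} (hp : p.IsHomogeneous n) :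
    (dualIntertwining R β k p).IsHomogeneous n := by
  rw [dualIntertwining_of_isHomogeneous R β k hp]
  exact isHomogeneous_dualIntertwiningPart R β k n p

/-- Linear maps agreeing on homogeneous polynomials agree. -/
theorem linearMap_ext_isHomogeneous {f g : CPoly d →ₗ[ℂ] CPoly d}
    (h : ∀ (n : ℕ) (p : CPoly d), p.IsHomogeneous n → f p = g p) : f = g := by
  ext1 m
  ext1
  exact h m.degree _ (MvPolynomial.isHomogeneous_monomial 1 rfl)

theorem eq_C_of_isHomogeneous_zero {p : CPoly d} (hp : p.IsHomogeneous 0) :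
    ∃ a, p = MvPolynomial.C a :=
  ⟨_, (MvPolynomial.homogeneousComponent_eq_self hp).symm.trans
    (MvPolynomial.homogeneousComponent_zero p)⟩

theorem polyDeriv_dualIntertwining {R : Finset (Euc d)} (hR : IsRootSystem R) {β : Euc d}
    (hβ : ∀ α ∈ R, ⟪α, β⟫_ℝ ≠ 0) {k : Euc d → ℂ} (hk : IsParameterFunction R k)
    (ξ : Euc d) (p : CPoly d) :
    polyDeriv ξ (dualIntertwining R β k p) = dualIntertwining R β k (dunklPoly R β k ξ p) := by
  have h : polyDerivLinear ξ ∘ₗ dualIntertwining R β k =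
      dualIntertwining R β k ∘ₗ dunklPoly R β k ξ := by
    refine linearMap_ext_isHomogeneous fun n p hp => ?_
    rw [LinearMap.comp_apply, LinearMap.comp_apply, polyDerivLinear_apply,
      dualIntertwining_of_isHomogeneous R β k hp]
    cases n with
    | zero =>
      obtain ⟨a, rfl⟩ := eq_C_of_isHomogeneous_zero hp
      rw [dunklPoly_C, map_zero]
      simp [dualIntertwiningPart, MvPolynomial.homogeneousComponent_zero, polyDeriv]
    | succ n =>
      rw [dualIntertwining_of_isHomogeneous R β k (IsHomogeneous.dunklPoly hp R β k ξ),
        dunklPoly_eq_sum, map_sum, polyDeriv]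
      exact Finset.sum_congr rfl fun j _ => by
        rw [pderiv_dualIntertwiningPart hR hβ hk, map_smul, MvPolynomial.smul_eq_C_mul]
  simpa [polyDerivLinear_apply] using congrArg (fun f => f p) h

/-- If `S p = 0` then `S T_ξ p = ∂_ξ S p = 0`, so every `T_ξ p` vanishes by induction on the degree.
The Euler identity then gives `W_n p = 0`, and injectivity of `W_n` finishes. -/
theorem eq_zero_of_dualIntertwining_eq_zero {R : Finset (Euc d)} (hR : IsRootSystem R) {β : Euc d}
    (hβ : ∀ α ∈ R, ⟪α, β⟫_ℝ ≠ 0) {k : Euc d → ℂ} (hk : IsParameterFunction R k)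
    (hM : IsMStar R β k) {n : ℕ} {p : CPoly d} (hp : p.IsHomogeneous n)
    (h : dualIntertwining R β k p = 0) : p = 0 := by
  induction n generalizing p with
  | zero =>
    obtain ⟨a, rfl⟩ := eq_C_of_isHomogeneous_zero hp
    rw [dualIntertwining_of_isHomogeneous R β k hp] at h
    simpa [dualIntertwiningPart, MvPolynomial.homogeneousComponent_zero] using h
  | succ n ih =>
    have hT : ∀ ξ, dunklPoly R β k ξ p = 0 := fun ξ =>
      ih (IsHomogeneous.dunklPoly hp R β k ξ) (by
        rw [← polyDeriv_dualIntertwining hR hβ hk, h]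
        simp [polyDeriv])
    have hW : opW R β k (n + 1) p = 0 := by
      refine polyFun_injective (funext fun x => ?_)
      rw [← dunklOperator_self R β k hp, ← polyFun_dunklPoly, hT]
    refine (hM (n + 1) (by omega)).injOn hp (Submodule.zero_mem _) ?_
    rw [hW]
    simp [opW, opA]

theorem dualIntertwining_injective {R : Finset (Euc d)} (hR : IsRootSystem R) {β : Euc d}
    (hβ : ∀ α ∈ R, ⟪α, β⟫_ℝ ≠ 0) {k : Euc d → ℂ} (hk : IsParameterFunction R k)
    (hM : IsMStar R β k) : Function.Injective (dualIntertwining R β k) := by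
  refine (injective_iff_map_eq_zero _).mpr fun p hp => ?_
  have hcomp : ∀ n, MvPolynomial.homogeneousComponent n p = 0 := by
    intro n
    refine eq_zero_of_dualIntertwining_eq_zero hR hβ hk hM
      (MvPolynomial.homogeneousComponent_isHomogeneous n p) ?_
    have h : MvPolynomial.homogeneousComponent n ∘ₗ dualIntertwining R β k =
        dualIntertwining R β k ∘ₗ MvPolynomial.homogeneousComponent n := by
      refine linearMap_ext_isHomogeneous fun m q hq => ?_
      rw [LinearMap.comp_apply, LinearMap.comp_apply,
        MvPolynomial.homogeneousComponent_of_mem (isHomogeneous_dualIntertwining R β k hq),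
        MvPolynomial.homogeneousComponent_of_mem hq]
      split_ifs <;> simp
    have h1 := congrArg (fun f => f p) h
    simp only [LinearMap.comp_apply, hp, map_zero] at h1
    exact h1.symm
  rw [← MvPolynomial.sum_homogeneousComponent p]
  exact Finset.sum_eq_zero fun n _ => hcomp n

theorem exists_dualIntertwining_eq {R : Finset (Euc d)} (hR : IsRootSystem R) {β : Euc d}
    (hβ : ∀ α ∈ R, ⟪α, β⟫_ℝ ≠ 0) {k : Euc d → ℂ} (hk : IsParameterFunction R k)
    (hM : IsMStar R β k) {n : ℕ} {p : CPoly d} (hp : p.IsHomogeneous n) :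
    ∃ q : CPoly d, q.IsHomogeneous n ∧ dualIntertwining R β k q = p := by
  have : FiniteDimensional ℂ (MvPolynomial.homogeneousSubmodule (Fin d) ℂ n) :=
    Module.Finite.iff_fg.mpr (MvPolynomial.homogeneousSubmodule_fg (Fin d) ℂ n)
  let f := (dualIntertwining R β k).restrict
    (p := MvPolynomial.homogeneousSubmodule (Fin d) ℂ n)
    (q := MvPolynomial.homogeneousSubmodule (Fin d) ℂ n)
    fun q hq => isHomogeneous_dualIntertwining R β k hq
  have hf : Function.Injective f := fun a b hab =>
    Subtype.ext (dualIntertwining_injective hR hβ hk hM (congrArg Subtype.val hab))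
  obtain ⟨q, hq⟩ := (LinearMap.injective_iff_surjective.mp hf) ⟨p, hp⟩
  exact ⟨q, q.2, congrArg Subtype.val hq⟩

/-- The intertwining operator exists for the parameters in `M^*`. -/
theorem exists_isIntertwining {R : Finset (Euc d)} (hR : IsRootSystem R) {β : Euc d}
    (hβ : ∀ α ∈ R, ⟪α, β⟫_ℝ ≠ 0) {k : Euc d → ℂ} (hk : IsParameterFunction R k)
    (hM : IsMStar R β k) : ∃ V, IsIntertwining R β k V := by
  have hinj := dualIntertwining_injective hR hβ hk hM
  have hsurj : Function.Surjective (dualIntertwining R β k) := by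
    intro p
    choose q _ hq using fun n => exists_dualIntertwining_eq hR hβ hk hM
      (MvPolynomial.homogeneousComponent_isHomogeneous n p)
    exact ⟨∑ n ∈ Finset.range (p.totalDegree + 1), q n, by
      rw [map_sum, ← MvPolynomial.sum_homogeneousComponent p]
      simp only [hq, MvPolynomial.sum_homogeneousComponent]⟩
  let S := LinearEquiv.ofBijective (dualIntertwining R β k) ⟨hinj, hsurj⟩
  refine ⟨S.symm, ⟨fun n p hp => ?_, ?_, fun ξ p x => ?_⟩⟩
  · obtain ⟨q, hq, rfl⟩ := exists_dualIntertwining_eq hR hβ hk hM hp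
    exact (S.symm_apply_apply q).symm ▸ hq
  · rw [LinearEquiv.symm_apply_eq]
    change 1 = dualIntertwining R β k 1
    rw [dualIntertwining_of_isHomogeneous R β k (MvPolynomial.isHomogeneous_one (Fin d) ℂ)]
    exact (MvPolynomial.homogeneousComponent_eq_self (MvPolynomial.isHomogeneous_one _ _)).symm
  · rw [← polyFun_dunklPoly]
    congr 1
    rw [LinearEquiv.eq_symm_apply]
    change dualIntertwining R β k _ = _
    rw [← polyDeriv_dualIntertwining hR hβ hk]
    exact congrArg _ (S.apply_symm_apply p)

theorem isIntertwining_intertwiningOperator {R : Finset (Euc d)} (hR : IsRootSystem R) {β : Euc d}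
    (hβ : ∀ α ∈ R, ⟪α, β⟫_ℝ ≠ 0) {k : Euc d → ℂ} (hk : IsParameterFunction R k)
    (hM : IsMStar R β k) : IsIntertwining R β k (intertwiningOperator R β k) := by
  have h := exists_isIntertwining hR hβ hk hM
  rw [intertwiningOperator, dif_pos h]
  exact h.choose_spec

/-! ### The Fourier transform of the kernels -/

/-- The polynomial `E_n(x, ·)`. -/
def dunklTermPoly (R : Finset (Euc d)) (β : Euc d) (k : Euc d → ℂ) (n : ℕ) (x : Fin d → ℂ) :
    CPoly d :=
  ∑ f : Fin n → Fin d, MvPolynomial.C ((n.factorial : ℂ)⁻¹ * MvPolynomial.eval x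
    (intertwiningOperator R β k (∏ i, MvPolynomial.X (f i)))) * ∏ i, MvPolynomial.X (f i)

/-- Shows that `E_n(x, ·)` is polynomial in the second variable, although `V_k` acts in the first.
The polynomial Fourier identity can then be applied to it. -/
theorem eval_dunklTermPoly (R : Finset (Euc d)) (β : Euc d) (k : Euc d → ℂ) (n : ℕ)
    (x w : Fin d → ℂ) :
    MvPolynomial.eval w (dunklTermPoly R β k n x) = dunklTerm R β k n x w := by
  have h := map_linForm_pow (intertwiningOperator R β k).toLinearMap w n
  simp only [LinearEquiv.coe_coe] at h
  rw [dunklTerm, h, dunklTermPoly, map_sum, map_sum, Finset.mul_sum]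
  refine Finset.sum_congr rfl fun f _ => ?_
  simp only [map_mul, MvPolynomial.eval_C, map_prod, MvPolynomial.eval_X, MvPolynomial.smul_eval]
  ring

theorem linForm_smul (c : ℂ) (w : Fin d → ℂ) : linForm (c • w) = c • linForm w := by
  simp [linForm, Finset.smul_sum, MvPolynomial.smul_eq_C_mul, mul_assoc]

theorem dunklTerm_smul_right (R : Finset (Euc d)) (β : Euc d) (k : Euc d → ℂ) (n : ℕ)
    (c : ℂ) (x w : Fin d → ℂ) : dunklTerm R β k n x (c • w) = c ^ n * dunklTerm R β k n x w := by
  simp only [dunklTerm, linForm_smul, smul_pow, map_smul, MvPolynomial.smul_eval]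
  ring

theorem IsHomogeneous.eval_smul {p : CPoly d} {n : ℕ} (hp : p.IsHomogeneous n) (c : ℂ)
    (x : Fin d → ℂ) : MvPolynomial.eval (c • x) p = c ^ n * MvPolynomial.eval x p := by
  rw [MvPolynomial.eval_eq, MvPolynomial.eval_eq, Finset.mul_sum]
  refine Finset.sum_congr rfl fun m hm => ?_
  have hdeg : m.degree = n := by
    rw [Finsupp.degree_eq_weight_one]
    exact hp (MvPolynomial.mem_support_iff.mp hm)
  simp only [Pi.smul_apply, smul_eq_mul, mul_pow, Finset.prod_mul_distrib, Finset.prod_pow_eq_pow_sum]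
  rw [← Finsupp.degree_apply, hdeg]
  ring

theorem IsIntertwining.dunklTerm_smul_left {R : Finset (Euc d)} {β : Euc d} {k : Euc d → ℂ}
    (hV : IsIntertwining R β k (intertwiningOperator R β k)) (n : ℕ) (c : ℂ) (x w : Fin d → ℂ) :
    dunklTerm R β k n (c • x) w = c ^ n * dunklTerm R β k n x w := by
  rw [dunklTerm, IsHomogeneous.eval_smul
    (hV.map_homogeneous n _ (isHomogeneous_linForm_pow w n)), dunklTerm]
  ring

/-- The Fourier transform of the Gaussian times the terms of the Dunkl kernel. -/
theorem IsIntertwining.fourierTransform_gaussian_mul_dunklTerm {R : Finset (Euc d)} {β : Euc d}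
    {k : Euc d → ℂ} (hV : IsIntertwining R β k (intertwiningOperator R β k)) (n : ℕ)
    (x : Fin d → ℂ) (y : Euc d) :
    fourierTransform (fun z => gaussian z * dunklTerm R β k n (Complex.I • x) (toComplex z)) y =
      gaussian y * lKernelTerm R β k n x y := by
  set p := dunklTermPoly R β k n x with hp
  obtain ⟨N, hN⟩ := fourierTransform_gaussian_mul_polyFun p
  obtain ⟨K, hK⟩ := exists_polyLaplacian_pow_eq_zero p
  have h1 : (fun z : Euc d => dunklTerm R β k n x (toComplex z)) = polyFun p :=
    funext fun z => (eval_dunklTermPoly R β k n x _).symm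
  -- Homogeneity in both variables moves the factor `i` from `x` to `z`.
  have h2 : ∀ z : Euc d, dunklTerm R β k n (Complex.I • x) (toComplex z) =
      polyFun (polyScaleI p) z := by
    intro z
    rw [polyFun_polyScaleI, hp, eval_dunklTermPoly, dunklTerm_smul_right, hV.dunklTerm_smul_left]
  rw [lKernelTerm, h1, expNegHalfLaplacian_polyFun (N := max N K)
    (fun m hm => hK m ((le_max_right _ _).trans hm)), ← hN _ (le_max_left _ _) y]
  simp only [h2]

theorem IsIntertwining.exists_norm_dunklTerm_le {R : Finset (Euc d)} {β : Euc d} {k : Euc d → ℂ}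
    (hV : IsIntertwining R β k (intertwiningOperator R β k)) (x : Fin d → ℂ) :
    ∃ C ρ : ℝ, ∀ (n : ℕ) (z : Euc d),
      ‖dunklTerm R β k n x (toComplex z)‖ ≤ C * ((ρ * ‖z‖) ^ n / n.factorial) := by
  obtain ⟨C, ρ, h⟩ := hV.exists_norm_eval_le x
  refine ⟨C, ρ, fun n z => ?_⟩
  rw [dunklTerm, norm_mul, norm_inv, Complex.norm_natCast, inv_mul_eq_div, ← mul_div_assoc]
  gcongr
  exact h n z

theorem hasSum_const_mul_exp (C t : ℝ) :
    HasSum (fun n : ℕ => C * (t ^ n / n.factorial)) (C * Real.exp t) := by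
  rw [Real.exp_eq_exp_ℝ]
  exact (NormedSpace.expSeries_div_hasSum_exp t).mul_left C

/-- Convergence of the kernels and the Fourier transform formula relating them. -/
theorem IsIntertwining.gaussian_mul_lKernel_eq {R : Finset (Euc d)} {β : Euc d} {k : Euc d → ℂ}
    (hV : IsIntertwining R β k (intertwiningOperator R β k)) (x : Fin d → ℂ) (y : Euc d) :
    (Summable fun n => lKernelTerm R β k n x y) ∧
    (∀ z : Euc d, Summable fun n => dunklTerm R β k n (Complex.I • x) (toComplex z)) ∧
    Integrable (fun z : Euc d => gaussian z * dunklKernel R β k (Complex.I • x) (toComplex z)) ∧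
    gaussian y * lKernel R β k x y =
      fourierTransform (fun z : Euc d =>
        gaussian z * dunklKernel R β k (Complex.I • x) (toComplex z)) y := by
  obtain ⟨C, ρ, hb⟩ := hV.exists_norm_dunklTerm_le (Complex.I • x)
  have hsum : ∀ z : Euc d, Summable fun n => dunklTerm R β k n (Complex.I • x) (toComplex z) :=
    fun z => Summable.of_norm_bounded (hasSum_const_mul_exp C (ρ * ‖z‖)).summable
      fun n => hb n z
  have hterm_cont : ∀ n, Continuous fun z : Euc d =>
      dunklTerm R β k n (Complex.I • x) (toComplex z) := fun n => by
    have : (fun z : Euc d => dunklTerm R β k n (Complex.I • x) (toComplex z)) =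
        polyFun (dunklTermPoly R β k n (Complex.I • x)) :=
      funext fun z => (eval_dunklTermPoly R β k n _ _).symm
    rw [this]
    exact continuous_polyFun _
  have hkernel_le : ∀ z : Euc d,
      ‖dunklKernel R β k (Complex.I • x) (toComplex z)‖ ≤ C * Real.exp (ρ * ‖z‖) :=
    fun z => tsum_of_norm_bounded (hasSum_const_mul_exp C (ρ * ‖z‖)) fun n => hb n z
  -- Measurability suffices: the kernel is a pointwise limit of polynomial partial sums.
  have hkernel_meas : Measurable fun z : Euc d =>
      dunklKernel R β k (Complex.I • x) (toComplex z) := by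
    refine measurable_of_tendsto_metrizable
      (f := fun N (z : Euc d) => ∑ n ∈ Finset.range N,
        dunklTerm R β k n (Complex.I • x) (toComplex z))
      (fun N => (continuous_finsetSum _ fun n _ => hterm_cont n).measurable) ?_
    exact tendsto_pi_nhds.mpr fun z => (hsum z).hasSum.tendsto_sum_nat
  have hbound_int := (integrable_gaussian_mul_exp_norm (d := d) ρ).const_mul C
  have hint : Integrable fun z : Euc d =>
      gaussian z * dunklKernel R β k (Complex.I • x) (toComplex z) := by
    refine hbound_int.mono'
      (continuous_gaussian.aestronglyMeasurable.mul hkernel_meas.aestronglyMeasurable)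
      (ae_of_all _ fun z => ?_)
    rw [norm_mul, norm_gaussian, mul_left_comm]
    gcongr
    exact hkernel_le z
  have hgs : ∀ z : Euc d, HasSum (fun n : ℕ => Real.exp (-‖z‖ ^ 2 / 2) *
      (C * ((ρ * ‖z‖) ^ n / n.factorial)))
      (C * (Real.exp (-‖z‖ ^ 2 / 2) * Real.exp (ρ * ‖z‖))) := fun z => by
    rw [mul_left_comm]
    exact (hasSum_const_mul_exp C (ρ * ‖z‖)).mul_left _
  -- The dominating series sums to `C e^{-‖z‖²/2} e^{ρ‖z‖}`, which is integrable.
  have key : HasSum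
      (fun n => ∫ z : Euc d, gaussian z * dunklTerm R β k n (Complex.I • x) (toComplex z) *
        Complex.exp (-Complex.I * ((⟪y, z⟫_ℝ : ℝ) : ℂ)))
      (∫ z : Euc d, gaussian z * dunklKernel R β k (Complex.I • x) (toComplex z) *
        Complex.exp (-Complex.I * ((⟪y, z⟫_ℝ : ℝ) : ℂ))) := by
    refine hasSum_integral_of_dominated_convergence
      (fun n z => Real.exp (-‖z‖ ^ 2 / 2) * (C * ((ρ * ‖z‖) ^ n / n.factorial)))
      (fun n => ((continuous_gaussian.mul (hterm_cont n)).mul (by fun_prop)).aestronglyMeasurable)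
      (fun n => ae_of_all _ fun z => ?_) (ae_of_all _ fun z => (hgs z).summable) ?_
      (ae_of_all _ fun z => ((hsum z).hasSum.mul_left _).mul_right _)
    · rw [norm_mul, norm_exp_neg_I_mul, mul_one, norm_mul, norm_gaussian]
      gcongr
      exact hb n z
    · simpa only [(hgs _).tsum_eq] using hbound_int
  have hF : HasSum (fun n => gaussian y * lKernelTerm R β k n x y)
      (fourierTransform (fun z : Euc d =>
        gaussian z * dunklKernel R β k (Complex.I • x) (toComplex z)) y) := by
    have h := key.mul_left ((((2 * Real.pi) ^ ((d : ℝ) / 2) : ℝ) : ℂ)⁻¹)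
    simp only [← hV.fourierTransform_gaussian_mul_dunklTerm]
    exact h
  have hg0 : gaussian y ≠ 0 := by
    rw [← norm_pos_iff, norm_gaussian]
    exact Real.exp_pos _
  -- Convergence of the series for `L_k` needs no separate estimate: its terms are the summable
  -- transforms divided by a nonzero Gaussian value.
  have hL : Summable fun n => lKernelTerm R β k n x y := (summable_mul_left_iff hg0).mp hF.summable
  exact ⟨hL, hsum, hint, (hL.hasSum.mul_left _).unique hF⟩

end

end DunklTheory

theorem mainTheorem6 (d : ℕ) (R : Finset (EuclideanSpace ℝ (Fin d)))
    (hR : DunklTheory.IsRootSystem R)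
    (β : EuclideanSpace ℝ (Fin d)) (hβ : ∀ α ∈ R, inner ℝ α β ≠ 0)
    (k : EuclideanSpace ℝ (Fin d) → ℂ) (hk : DunklTheory.IsParameterFunction R k)
    (hkM : DunklTheory.IsMStar R β k)
    (x : Fin d → ℂ) (y : EuclideanSpace ℝ (Fin d)) :
    (Summable fun n => DunklTheory.lKernelTerm R β k n x y) ∧
    (∀ z : EuclideanSpace ℝ (Fin d), Summable fun n =>
      DunklTheory.dunklTerm R β k n (Complex.I • x) (DunklTheory.toComplex z)) ∧
    MeasureTheory.Integrable (fun z : EuclideanSpace ℝ (Fin d) => DunklTheory.gaussian z *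
      DunklTheory.dunklKernel R β k (Complex.I • x) (DunklTheory.toComplex z)) ∧
    DunklTheory.gaussian y * DunklTheory.lKernel R β k x y =
      DunklTheory.fourierTransform (fun z : EuclideanSpace ℝ (Fin d) => DunklTheory.gaussian z *
        DunklTheory.dunklKernel R β k (Complex.I • x) (DunklTheory.toComplex z)) y :=
  (DunklTheory.isIntertwining_intertwiningOperator hR hβ hk hkM).gaussian_mul_lKernel_eq x y
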